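/- Let $T>0$ and let $U:\mathbb{R}\times\mathbb{R}^2\to\mathbb{R}$ be a $\mathcal{C}^1$ function, $T$-periodic in the first variable, such that for some $C>0$ and $\alpha\in(0,2)$ one has $|U(t,x)|\le C(1+|x|^\alpha)$ for all $(t,x)\in\mathbb{R}\times\mathbb{R}^2$. Let $H^1_T$ be the space of $H^1$ functions $x:[0,T]\to\mathbb{R}^2$ with $x(0)=x(T)$ (extended $T$-periodically to $\mathbb{R}$), and let $\mathcal{X}\subset H^1_T$ be the set of those $x$ which either vanish at some point of $[0,T]$, or never vanish and have nonzero winding number around the origin. For $a<b$ set $$A_{[a,b]}(x)=\int_a^b\Big(\tfrac12|\dot x(t)|^2+\tfrac1{|x(t)|}+U(t,x(t))\Big)\,dt\in(-\infty,+\infty],$$ where $1/|x(t)|=+\infty$ if $x(t)=0$, and $A_T=A_{[0,T]}$. Let $x\in\mathcal{X}$ satisfy $A_T(x)=\min_{y\in\mathcal{X}}A_T(y)$ and let $t_0\in[0,T]$ be a collision time, that is, $x(t_0)=0$. For every sufficiently small $\delta>0$ there is a unique pair of numbers $t_\delta^-,t_\delta^+>0$ such that $$|x(t_0-t_\delta^-)|=|x(t_0+t_\delta^+)|=\delta,\qquad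 |x(t)|<\delta\quad\text{for all }t\in(t_0-t_\delta^-,t_0+t_\delta^+).$$ Put $\sigma_\delta^\pm=t_\delta^\pm/\delta^{3/2}$ and let $s_0>0$ be the number with $\sqrt[3]{\tfrac92 s_0^2}=1$. For unit vectors $x_0^-,x_0^+\in\mathbb{R}^2$ let $\zeta_0(t)=\sqrt[3]{9/2}\,|t|^{2/3}x_0^+$ for $t\ge0$ and $\zeta_0(t)=\sqrt[3]{9/2}\,|t|^{2/3}x_0^-$ for $t<0$ (the parabolic collision solution of the Kepler problem), and let $$\varphi_0=\int_{-s_0}^{s_0}\Big(\tfrac12|\dot\zeta_0(t)|^2+\tfrac1{|\zeta_0(t)|}\Big)\,dt .$$ Then $\varphi_0=4\sqrt[6]{8}$, whatever the unit vectors $x_0^\pm$ are, and $$\lim_{\delta\to0^+}\sigma_\delta^+=\lim_{\delta\to0^+}\sigma_\delta^-=s_0,\qquad \liminf_{\delta\to0^+}\frac{A_{[t_0-t_\delta^-,\,t_0+t_\delta^+]}(x)}{\delta^{1/2}}\ge\varphi_0 .$$ -/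

import Mathlib

open Set Filter Topology MeasureTheory
open scoped ENNReal

noncomputable section

namespace ForcedKepler

/-- The Euclidean plane. -/
abbrev Plane : Type := EuclideanSpace ℝ (Fin 2)

/-- The Sobolev space of `H¹` loops on `[0, T]` with equal values at the endpoints. A loop is
represented by the `T`-periodic extension to `ℝ` of its continuous representative; `H¹` means
absolutely continuous with square integrable derivative. -/
def SobolevLoop (T : ℝ) (x : ℝ → Plane) : Prop :=
  Function.Periodic x T ∧ AbsolutelyContinuousOnInterval x 0 T ∧
    MemLp (deriv x) 2 (volume.restrict (Icc 0 T))

/-- `θ` is a continuous choice of the polar angle along `x` on `[0, T]`. -/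
def IsPolarAngle (T : ℝ) (x : ℝ → Plane) (θ : ℝ → ℝ) : Prop :=
  ContinuousOn θ (Icc 0 T) ∧
    ∀ t ∈ Icc 0 T, x t = ‖x t‖ • (!₂[Real.cos (θ t), Real.sin (θ t)] : Plane)

/-- Loops which pass through the origin. -/
def collisionLoops (T : ℝ) : Set (ℝ → Plane) :=
  {x | SobolevLoop T x ∧ ∃ t ∈ Icc 0 T, x t = 0}

/-- Loops which avoid the origin and have nonzero winding number around it. -/
def windingLoops (T : ℝ) : Set (ℝ → Plane) :=
  {x | SobolevLoop T x ∧ (∀ t ∈ Icc 0 T, x t ≠ 0) ∧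
    ∃ θ, IsPolarAngle T x θ ∧ (θ T - θ 0) / (2 * Real.pi) ≠ 0}

/-- The set of loops on which the action is minimized. -/
def admissibleLoops (T : ℝ) : Set (ℝ → Plane) :=
  collisionLoops T ∪ windingLoops T

/-- The unperturbed Kepler action `∫ (|x'|² / 2 + 1 / |x|)` on `[a, b]`, with value in `[0, ∞]`.
The inverse is the one of `[0, ∞]`, hence `1 / |x| = ∞` at `x = 0`. -/
def keplerAction (a b : ℝ) (x : ℝ → Plane) : ℝ≥0∞ :=
  ∫⁻ t in Icc a b, (‖deriv x t‖ₑ ^ 2 / 2 + ‖x t‖ₑ⁻¹)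

/-- The action `∫ (|x'|² / 2 + 1 / |x| + U(t, x))` on `[a, b]`, with value in `(-∞, ∞]`. -/
def action (U : ℝ → Plane → ℝ) (a b : ℝ) (x : ℝ → Plane) : EReal :=
  (keplerAction a b x : EReal) + ((∫ t in a..b, U t (x t) : ℝ) : EReal)

/-- `x` minimizes the action over one period among all admissible loops. -/
def IsActionMinimizer (U : ℝ → Plane → ℝ) (T : ℝ) (x : ℝ → Plane) : Prop :=
  x ∈ admissibleLoops T ∧ ∀ y ∈ admissibleLoops T, action U 0 T x ≤ action U 0 T y

/-- `[t₀ - r, t₀ + s]` is the time interval around the collision time `t₀` that `x` spends in the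
disc of radius `δ`. -/
structure IsExitTimes (x : ℝ → Plane) (t₀ δ r s : ℝ) : Prop where
  left_pos : 0 < r
  right_pos : 0 < s
  norm_left : ‖x (t₀ - r)‖ = δ
  norm_right : ‖x (t₀ + s)‖ = δ
  norm_lt : ∀ t ∈ Ioo (t₀ - r) (t₀ + s), ‖x t‖ < δ

/-- The colliding parabolic Kepler motion with ingoing direction `u` and outgoing direction `v`. -/
def parabolic (u v : Plane) (t : ℝ) : Plane :=
  ((9 / 2 : ℝ) ^ (1 / 3 : ℝ) * |t| ^ (2 / 3 : ℝ)) • (if 0 ≤ t then v else u)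

end ForcedKepler

end

open scoped NNReal

noncomputable section

namespace ForcedKepler

/-! The proof squeezes the action of the arc from the collision to the circle of radius $\delta$
between two explicit bounds. It uses neither blow-up nor compactness nor the equations of motion.

Lower bound (`calibration`). Let $F_l(r)=2\sqrt2\,\sqrt r+\tfrac23\,l\,r^{3/2}$, so that
$F_l'=\sqrt2/\sqrt r+l\sqrt r$. Young's inequality gives $F_l'(r)\,\dot r\le\tfrac12\dot
r^2+\tfrac1r+\sqrt2\,l+\tfrac12l^2r$ with $r=|x|$, and $|\dot r|\le|\dot x|$. Integrating, the
Kepler action on an interval where $|x|\le d$ is at least the increment of $F_l(|x|)$ minus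
$(\sqrt2\,l+\tfrac12l^2d)$ times the length. The slope $l$ is a free real parameter, of either sign.

Upper bound (`IsCollisionMinimizer.comparison`). Put the collision at time $0$ and replace $x$ on
$[0,s]$ by the radial parabolic arc reaching $x(s)$ at time $\tau$; then run the rest of $x$ at a
slightly changed speed so that it still ends at time $T$. The arc costs $2\sqrt2\sqrt{|x(s)|}$,
exactly the calibration value for $l=0$, and the change of speed costs $O(s+\tau)$. Minimality
bounds the Kepler action of $x$ on $[0,s]$ by the sum.

Take for $s$ the exit time, $\tau=s_0\delta^{3/2}$, $\sigma=s/\delta^{3/2}$ and $l=\mu/\delta$.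
Since $\sqrt2\,s_0=\tfrac23$, the two bounds combine to
$\sqrt2\,\mu(s_0-\sigma)\le\tfrac12\mu^2\sigma+C\delta(\sigma+s_0)$ for every real $\mu$. Small
$\mu$ of both signs force $\sigma\to s_0$ (`tendsto_of_calibrated`). For the liminf, $l=0$ on each
side gives $4\sqrt2\sqrt\delta=\varphi_0\sqrt\delta$, while $U$ contributes only $O(\delta^{3/2})$.
The incoming branch is the outgoing branch of the time-reversed loop. -/

/-! ### Operations on absolutely continuous functions -/

open AbsolutelyContinuousOnInterval in
theorem _root_.LipschitzOnWith.comp_absolutelyContinuousOnInterval {X Y : Type*}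
    [PseudoMetricSpace X] [PseudoMetricSpace Y] {f : ℝ → X} {g : X → Y} {s : Set X} {K : ℝ≥0}
    {a b : ℝ} (hg : LipschitzOnWith K g s) (hf : AbsolutelyContinuousOnInterval f a b)
    (hs : MapsTo f (uIcc a b) s) : AbsolutelyContinuousOnInterval (fun t => g (f t)) a b := by
  rw [absolutelyContinuousOnInterval_iff] at hf ⊢
  intro ε hε
  obtain ⟨δ, hδ, h⟩ := hf (ε / (K + 1)) (by positivity)
  refine ⟨δ, hδ, fun E hE hl => ?_⟩
  have h1 := h E hE hl
  rw [lt_div_iff₀ (by positivity)] at h1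
  refine lt_of_le_of_lt ?_ h1
  rw [Finset.sum_mul]
  refine Finset.sum_le_sum fun i hi => ?_
  have h2 := hg.dist_le_mul _ (hs (hE.1 i hi).1) _ (hs (hE.1 i hi).2)
  have h3 : 0 ≤ dist (f (E.2 i).1) (f (E.2 i).2) := dist_nonneg
  nlinarith

theorem disjoint_uIoc_image {φ : ℝ → ℝ} (hφ : Monotone φ ∨ Antitone φ) {u v u' v' : ℝ}
    (h : Disjoint (uIoc u v) (uIoc u' v')) :
    Disjoint (uIoc (φ u) (φ v)) (uIoc (φ u') (φ v')) := by
  simp only [uIoc, Ioc_disjoint_Ioc] at h ⊢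
  rcases hφ with hφ | hφ
  · simp only [← hφ.map_max, ← hφ.map_min]
    exact hφ h
  · simp only [← hφ.map_max, ← hφ.map_min]
    apply hφ
    grind

-- Monotonicity of the inner map keeps disjoint intervals disjoint, and the Lipschitz bound controls
-- their total length.
open AbsolutelyContinuousOnInterval in
theorem _root_.AbsolutelyContinuousOnInterval.comp_lipschitz {X : Type*} [PseudoMetricSpace X]
    {f : ℝ → X} {φ : ℝ → ℝ} {K : ℝ≥0} {a b : ℝ} (hφ : Monotone φ ∨ Antitone φ)
    (hK : LipschitzWith K φ) (hf : AbsolutelyContinuousOnInterval f (φ a) (φ b)) :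
    AbsolutelyContinuousOnInterval (fun t => f (φ t)) a b := by
  rw [absolutelyContinuousOnInterval_iff] at hf ⊢
  intro ε hε
  obtain ⟨δ, hδ, h⟩ := hf ε hε
  refine ⟨δ / (K + 1), by positivity, fun E hE hl => ?_⟩
  rw [lt_div_iff₀ (by positivity)] at hl
  have hm : ∀ t ∈ uIcc a b, φ t ∈ uIcc (φ a) (φ b) := by
    intro t ht
    rw [mem_uIcc] at ht ⊢
    rcases hφ with hφ | hφ <;> rcases ht with ht | ht
    · exact Or.inl ⟨hφ ht.1, hφ ht.2⟩
    · exact Or.inr ⟨hφ ht.1, hφ ht.2⟩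
    · exact Or.inr ⟨hφ ht.2, hφ ht.1⟩
    · exact Or.inl ⟨hφ ht.2, hφ ht.1⟩
  refine h (E.1, fun i => (φ (E.2 i).1, φ (E.2 i).2)) ⟨fun i hi => ⟨hm _ (hE.1 i hi).1,
    hm _ (hE.1 i hi).2⟩, fun i hi j hj hij => disjoint_uIoc_image hφ (hE.2 hi hj hij)⟩ ?_
  refine lt_of_le_of_lt ?_ hl
  rw [Finset.sum_mul]
  refine Finset.sum_le_sum fun i hi => ?_
  have h2 := hK.dist_le_mul (E.2 i).1 (E.2 i).2
  have h3 : 0 ≤ dist (E.2 i).1 (E.2 i).2 := dist_nonneg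
  simp only
  nlinarith

theorem _root_.AbsolutelyContinuousOnInterval.glue {F : Type*} [SeminormedAddCommGroup F]
    {f : ℝ → F} {a b c : ℝ} (hab : a ≤ b) (hbc : b ≤ c)
    (h₁ : AbsolutelyContinuousOnInterval f a b) (h₂ : AbsolutelyContinuousOnInterval f b c) :
    AbsolutelyContinuousOnInterval f a c := by
  -- Stopping $f$ at $b$ and starting it at $b$ are compositions with monotone 1-Lipschitz maps, so
  -- gluing reduces to sums.
  have e : f = (fun t => f (min t b)) + (fun t => f (max t b)) - fun _ => f b := by
    funext t
    rcases le_total t b with h | h <;> simp [h]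
  rw [e]
  have hc : AbsolutelyContinuousOnInterval (fun _ : ℝ => f b) a c :=
    (LipschitzWith.const (f b)).lipschitzOnWith.absolutelyContinuousOnInterval
  refine (AbsolutelyContinuousOnInterval.add ?_ ?_).sub hc
  · refine AbsolutelyContinuousOnInterval.comp_lipschitz (K := 1)
      (Or.inl (monotone_id.min monotone_const)) (LipschitzWith.id.min_const b) ?_
    simpa [hab, hbc] using h₁
  · refine AbsolutelyContinuousOnInterval.comp_lipschitz (K := 1)
      (Or.inl (monotone_id.max monotone_const)) (LipschitzWith.id.max_const b) ?_
    simpa [hab, hbc] using h₂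

theorem _root_.AbsolutelyContinuousOnInterval.congr {X : Type*} [PseudoMetricSpace X]
    {f g : ℝ → X} {a b : ℝ} (hf : AbsolutelyContinuousOnInterval f a b)
    (h : EqOn f g (uIcc a b)) : AbsolutelyContinuousOnInterval g a b := by
  rw [absolutelyContinuousOnInterval_iff] at hf ⊢
  intro ε hε
  obtain ⟨δ, hδ, h'⟩ := hf ε hε
  refine ⟨δ, hδ, fun E hE hl => lt_of_eq_of_lt (Finset.sum_congr rfl fun i hi => ?_) (h' E hE hl)⟩
  rw [h (hE.1 i hi).1, h (hE.1 i hi).2]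

theorem _root_.AbsolutelyContinuousOnInterval.comp_const_add {X : Type*} [PseudoMetricSpace X]
    {f : ℝ → X} {a b c : ℝ} (hf : AbsolutelyContinuousOnInterval f (c + a) (c + b)) :
    AbsolutelyContinuousOnInterval (fun t => f (c + t)) a b :=
  AbsolutelyContinuousOnInterval.comp_lipschitz (K := 1)
    (Or.inl fun _ _ h => by simpa using h)
    (LipschitzWith.of_dist_le_mul fun _ _ => by simp) hf

theorem _root_.AbsolutelyContinuousOnInterval.comp_neg {X : Type*} [PseudoMetricSpace X]
    {f : ℝ → X} {a b : ℝ} (hf : AbsolutelyContinuousOnInterval f (-a) (-b)) :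
    AbsolutelyContinuousOnInterval (fun t => f (-t)) a b :=
  AbsolutelyContinuousOnInterval.comp_lipschitz (K := 1)
    (Or.inr fun _ _ h => by simpa using h)
    (LipschitzWith.of_dist_le_mul fun _ _ => by simp) hf

theorem _root_.AbsolutelyContinuousOnInterval.of_periodic {F : Type*} [SeminormedAddCommGroup F]
    {f : ℝ → F} {T a : ℝ} (hT : 0 < T) (hf : Function.Periodic f T)
    (h : AbsolutelyContinuousOnInterval f a (a + T)) (b : ℝ) :
    AbsolutelyContinuousOnInterval f b (b + T) := by
  have key : ∀ n : ℤ, AbsolutelyContinuousOnInterval f (a + n * T) (a + n * T + T) := by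
    intro n
    have e : f = fun t => f (-(n * T) + t) := by
      funext t
      have := hf.sub_int_mul_eq (x := t) n
      rw [← this]; congr 1; ring
    rw [e]
    apply AbsolutelyContinuousOnInterval.comp_const_add
    convert! h using 1 <;> ring
  -- The window starting at $b$ is covered by two consecutive translates of the given period.
  obtain ⟨n, hn, -⟩ := existsUnique_add_zsmul_mem_Ico hT b a
  simp only [zsmul_eq_mul, mem_Ico] at hn
  have h2 := key (-n)
  have h0 := key (-n + 1)
  push_cast at h0 h2
  have hg := AbsolutelyContinuousOnInterval.glue (a := a + -n * T) (b := a + -n * T + T)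
    (c := a + (-n + 1) * T + T) (by linarith) (by nlinarith) h2
    (by convert! h0 using 1; ring)
  refine hg.mono ?_
  rw [uIcc_of_le (by linarith), uIcc_of_le (by nlinarith)]
  exact Icc_subset_Icc (by nlinarith) (by nlinarith)

/-! ### The Kepler action under cutting, translation, reversal and change of speed -/

theorem setLIntegral_affine {m : ℝ} (hm : m ≠ 0) (d : ℝ) (s : Set ℝ) (hs : MeasurableSet s)
    (g : ℝ → ℝ≥0∞) :
    ∫⁻ v in (fun t => m * t + d) '' s, g v = ENNReal.ofReal |m| * ∫⁻ t in s, g (m * t + d) := by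
  rw [lintegral_image_eq_lintegral_abs_deriv_mul (f := fun t => m * t + d) (f' := fun _ => m) hs
    (fun t _ => by simpa using (((hasDerivAt_id t).const_mul m).add_const d).hasDerivWithinAt)
    (fun u _ v _ h => by simpa [hm] using h), lintegral_const_mul' _ _ ENNReal.ofReal_ne_top]

/-- Agreement on the open interval also identifies the derivatives there, and the endpoints are
null. This is what lets pieces of competitors be replaced. -/
theorem keplerAction_congr {a b : ℝ} {x y : ℝ → Plane} (h : EqOn x y (Ioo a b)) :
    keplerAction a b x = keplerAction a b y := by
  unfold keplerAction
  rw [setLIntegral_congr Ioo_ae_eq_Icc.symm, setLIntegral_congr Ioo_ae_eq_Icc.symm]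
  refine setLIntegral_congr_fun measurableSet_Ioo fun t ht => ?_
  rw [h ht, (h.eventuallyEq_of_mem (isOpen_Ioo.mem_nhds ht)).deriv_eq]

theorem keplerAction_add {a b c : ℝ} (hab : a ≤ b) (hbc : b ≤ c) (x : ℝ → Plane) :
    keplerAction a c x = keplerAction a b x + keplerAction b c x := by
  unfold keplerAction
  rw [setLIntegral_congr (Ioc_ae_eq_Icc (a := b)).symm, ← lintegral_union measurableSet_Ioc
    (disjoint_left.2 fun t h h' => not_lt_of_ge h.2 h'.1), Icc_union_Ioc_eq_Icc hab hbc]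

theorem keplerAction_const_add (a b c : ℝ) (x : ℝ → Plane) :
    keplerAction a b (fun t => x (c + t)) = keplerAction (c + a) (c + b) x := by
  unfold keplerAction
  have := setLIntegral_affine (m := 1) one_ne_zero c (Icc a b) measurableSet_Icc
    fun v => ‖deriv x v‖ₑ ^ 2 / 2 + ‖x v‖ₑ⁻¹
  simp only [one_mul, abs_one, ENNReal.ofReal_one, image_add_const_Icc] at this
  rw [add_comm c a, add_comm c b, this]
  simp only [add_comm c, deriv_comp_add_const]

theorem keplerAction_neg (a b : ℝ) (x : ℝ → Plane) :
    keplerAction a b (fun t => x (-t)) = keplerAction (-b) (-a) x := by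
  unfold keplerAction
  have := setLIntegral_affine (m := -1) (by norm_num) 0 (Icc a b) measurableSet_Icc
    fun v => ‖deriv x v‖ₑ ^ 2 / 2 + ‖x v‖ₑ⁻¹
  simp only [neg_mul, one_mul, abs_neg, abs_one, ENNReal.ofReal_one, image_neg_Icc, add_zero] at this
  rw [this]
  simp only [deriv_comp_neg, enorm_neg]

/-- Changing the speed by $m$ multiplies the kinetic part by $m^2\cdot m^{-1}=m$ and the potential
part by $m^{-1}$; the factor $k$ dominates both. -/
theorem keplerAction_affine_le {m : ℝ} (hm : 0 < m) {k : ℝ} (hk : m ≤ k) (hk' : m⁻¹ ≤ k)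
    (a b d : ℝ) (x : ℝ → Plane) :
    keplerAction a b (fun t => x (m * t + d)) ≤
      ENNReal.ofReal k * keplerAction (m * a + d) (m * b + d) x := by
  have h0 := setLIntegral_affine hm.ne' d (Icc a b) measurableSet_Icc
    fun v => ‖deriv x v‖ₑ ^ 2 / 2 + ‖x v‖ₑ⁻¹
  have him : (fun t => m * t + d) '' Icc a b = Icc (m * a + d) (m * b + d) :=
    image_affine_Icc' hm d a b
  rw [him, abs_of_pos hm] at h0
  unfold keplerAction
  rw [h0, ← mul_assoc, ← lintegral_const_mul' _ _ (by finiteness)]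
  refine lintegral_mono fun t => ?_
  have hd : deriv (fun t => x (m * t + d)) t = m • deriv x (m * t + d) := by
    have := deriv_comp_mul_left m (fun s => x (s + d)) t
    rw [this, deriv_comp_add_const]
  rw [hd, enorm_smul, mul_add, ← ENNReal.ofReal_mul (hm.le.trans hk)]
  have e : ‖m‖ₑ = ENNReal.ofReal m := by rw [Real.enorm_eq_ofReal hm.le]
  have hkm : 1 ≤ k * m := by
    have := mul_le_mul_of_nonneg_right hk' hm.le
    rwa [inv_mul_cancel₀ hm.ne'] at this
  refine add_le_add ?_ ?_
  · rw [mul_pow, mul_div_assoc, e, ← ENNReal.ofReal_pow hm.le]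
    refine mul_le_mul' (ENNReal.ofReal_le_ofReal ?_) le_rfl
    nlinarith
  · refine le_mul_of_one_le_left' ?_
    simpa using hkm

theorem deriv_periodic {x : ℝ → Plane} {T : ℝ} (hx : Function.Periodic x T) :
    Function.Periodic (deriv x) T := fun t => by
  rw [← deriv_comp_add_const, hx.funext]

theorem keplerAction_periodic {x : ℝ → Plane} {T : ℝ} (hT : 0 < T) (hx : Function.Periodic x T)
    (a b : ℝ) : keplerAction a (a + T) x = keplerAction b (b + T) x := by
  unfold keplerAction
  rw [setLIntegral_congr Ioc_ae_eq_Icc.symm, setLIntegral_congr Ioc_ae_eq_Icc.symm]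
  refine (isAddFundamentalDomain_Ioc hT a).setLIntegral_eq (isAddFundamentalDomain_Ioc hT b) _ ?_
  rintro ⟨g, n, rfl⟩ t
  have h1 := (hx.zsmul n) t
  have h2 := ((deriv_periodic hx).zsmul n) t
  simp only [AddSubgroup.vadd_def, vadd_eq_add]
  rw [add_comm _ t, h1, h2]

/-- Because of this, the $H^1$ condition on a competitor need not be checked apart from finiteness
of its action. -/
theorem memLp_deriv_of_keplerAction {a b : ℝ} {x : ℝ → Plane} (h : keplerAction a b x ≠ ⊤) :
    MemLp (deriv x) 2 (volume.restrict (Icc a b)) := by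
  refine ⟨(stronglyMeasurable_deriv x).aestronglyMeasurable, ?_⟩
  rw [eLpNorm_lt_top_iff_lintegral_rpow_enorm_lt_top (by norm_num) (by norm_num)]
  have h1 : ∫⁻ t in Icc a b, ‖deriv x t‖ₑ ^ 2 / 2 ≠ ⊤ :=
    ne_top_of_le_ne_top h (lintegral_mono fun t => le_self_add)
  have h2 : ∫⁻ t in Icc a b, ‖deriv x t‖ₑ ^ 2 = 2 * ∫⁻ t in Icc a b, ‖deriv x t‖ₑ ^ 2 / 2 := by
    rw [← lintegral_const_mul' _ _ (by finiteness)]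
    refine lintegral_congr fun t => ?_
    rw [ENNReal.mul_div_cancel (by norm_num) (by norm_num)]
  simp only [ENNReal.toReal_ofNat, ENNReal.rpow_ofNat]
  rw [h2]
  finiteness

/-! ### Lower bound by calibration -/

/-- A primitive of `√2 / √r + l √r`, which calibrates the Kepler action. -/
def calibrator (l r : ℝ) : ℝ := 2 * √2 * √r + 2 / 3 * l * √r ^ 3

theorem hasDerivAt_calibrator (l : ℝ) {r : ℝ} (hr : 0 < r) :
    HasDerivAt (calibrator l) (√2 / √r + l * √r) r := by
  have h := Real.hasDerivAt_sqrt hr.ne'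
  have hs : √r ≠ 0 := (Real.sqrt_pos.2 hr).ne'
  refine ((h.const_mul (2 * √2)).add ((h.pow 3).const_mul (2 / 3 * l))).congr_deriv ?_
  field_simp
  norm_num
  ring

theorem continuous_calibrator (l : ℝ) : Continuous (calibrator l) := by
  unfold calibrator; fun_prop

theorem contDiffOn_calibrator (l : ℝ) : ContDiffOn ℝ 1 (calibrator l) (Ioi 0) := by
  intro r hr
  have h : ContDiffAt ℝ 1 Real.sqrt r := Real.contDiffAt_sqrt (ne_of_gt hr)
  exact ((contDiffAt_const.mul h).add (contDiffAt_const.mul (h.pow 3))).contDiffWithinAt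

/-- Young's inequality $pv\le\tfrac12v^2+\tfrac12p^2$ for the slope $p$ of the calibrator at $r+e$:
the square $\tfrac12p^2$ is $1/(r+e)+\sqrt2\,l+\tfrac12l^2(r+e)$, and moving from $r+e$ to $r$ only
enlarges the Kepler term. -/
theorem calibration_pointwise {l v w r e d : ℝ} (hv : |v| ≤ w) (hr : 0 < r) (he : 0 ≤ e)
    (hd : r + e ≤ d) :
    (√2 / √(r + e) + l * √(r + e)) * v - (√2 * l + l ^ 2 * d / 2) ≤ w ^ 2 / 2 + r⁻¹ := by
  have hR : 0 < r + e := by positivity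
  set q := √(r + e) with hq
  have hq0 : 0 < q := Real.sqrt_pos.2 hR
  have hq2 : q ^ 2 = r + e := Real.sq_sqrt hR.le
  have h2 : √2 ^ 2 = (2 : ℝ) := Real.sq_sqrt (by norm_num)
  have h1 : (√2 / q + l * q) ^ 2 / 2 = (q ^ 2)⁻¹ + √2 * l + l ^ 2 * q ^ 2 / 2 := by
    field_simp
    linear_combination h2
  have h3 : (q ^ 2)⁻¹ ≤ r⁻¹ := by rw [hq2]; exact inv_anti₀ hr (by linarith)
  have h4 : v ^ 2 ≤ w ^ 2 := sq_le_sq' (by linarith [neg_abs_le v]) (by linarith [le_abs_self v])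
  have h5 : l ^ 2 * q ^ 2 ≤ l ^ 2 * d := mul_le_mul_of_nonneg_left (hq2.le.trans hd) (sq_nonneg l)
  nlinarith [sq_nonneg (v - (√2 / q + l * q))]

theorem abs_deriv_norm_le {x : ℝ → Plane} {t : ℝ} (hx : DifferentiableAt ℝ x t) (h : x t ≠ 0) :
    DifferentiableAt ℝ (fun s => ‖x s‖) t ∧ |deriv (fun s => ‖x s‖) t| ≤ ‖deriv x t‖ := by
  have hd : DifferentiableAt ℝ (fun s => ‖x s‖) t := hx.norm ℝ h
  refine ⟨hd, ?_⟩
  refine le_of_tendsto_of_tendsto hd.hasDerivAt.tendsto_slope.norm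
    hx.hasDerivAt.tendsto_slope.norm (Eventually.of_forall fun s => ?_)
  simp only [slope, vsub_eq_sub, norm_smul]
  exact mul_le_mul_of_nonneg_left (abs_norm_sub_norm_le _ _) (norm_nonneg _)

theorem ae_differentiableAt_plane {x : ℝ → Plane} {a b : ℝ}
    (hx : AbsolutelyContinuousOnInterval x a b) :
    ∀ᵐ t, t ∈ uIcc a b → DifferentiableAt ℝ x t :=
  hx.boundedVariationOn.ae_differentiableAt_of_mem_uIcc

theorem ofReal_integral_le_lintegral {X : Type*} [MeasurableSpace X] {μ : Measure X} {f : X → ℝ}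
    (hf : Integrable f μ) : ENNReal.ofReal (∫ t, f t ∂μ) ≤ ∫⁻ t, ENNReal.ofReal (f t) ∂μ := by
  have h := ofReal_integral_eq_lintegral_ofReal hf.pos_part
    (Eventually.of_forall fun t => le_max_right _ _)
  simp only [ENNReal.ofReal_max, ENNReal.ofReal_zero, zero_le, sup_of_le_left] at h
  rw [← h]
  exact ENNReal.ofReal_le_ofReal (integral_mono hf hf.pos_part fun t => le_max_left _ _)

/-- The calibrator has infinite slope at the origin. The shift by $e>0$ makes it Lipschitz on the
range of $|x|+e$, so the composition is absolutely continuous even through collisions. -/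
theorem calibration_shifted {x : ℝ → Plane} {a b d e : ℝ} (hab : a ≤ b)
    (hx : AbsolutelyContinuousOnInterval x a b) (hd : ∀ t ∈ Icc a b, ‖x t‖ ≤ d) (he : 0 < e)
    (l : ℝ) :
    ENNReal.ofReal (calibrator l (‖x b‖ + e) - calibrator l (‖x a‖ + e) -
      (√2 * l + l ^ 2 * (d + e) / 2) * (b - a)) ≤ keplerAction a b x := by
  have hmap : MapsTo (fun t => ‖x t‖ + e) (Icc a b) (Icc e (d + e)) := fun t ht =>
    ⟨by linarith [norm_nonneg (x t)], by linarith [hd t ht]⟩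
  obtain ⟨K, hK⟩ := ((contDiffOn_calibrator l).mono
    (fun r hr => lt_of_lt_of_le he hr.1 : Icc e (d + e) ⊆ Ioi 0)).exists_lipschitzOnWith
    one_ne_zero (convex_Icc _ _) isCompact_Icc
  have hn : AbsolutelyContinuousOnInterval (fun t => ‖x t‖ + e) a b :=
    LipschitzOnWith.comp_absolutelyContinuousOnInterval (g := fun v : Plane => ‖v‖ + e) (K := 1)
      (LipschitzWith.lipschitzOnWith (s := univ) (LipschitzWith.of_dist_le_mul fun v w => by
        simpa [Real.dist_eq, dist_eq_norm] using abs_norm_sub_norm_le v w)) hx (mapsTo_univ _ _)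
  have hF : AbsolutelyContinuousOnInterval (fun t => calibrator l (‖x t‖ + e)) a b :=
    hK.comp_absolutelyContinuousOnInterval hn (by rwa [uIcc_of_le hab])
  set F := fun t => calibrator l (‖x t‖ + e) with hFdef
  set c := √2 * l + l ^ 2 * (d + e) / 2 with hc
  have hint : IntervalIntegrable (fun t => deriv F t - c) volume a b :=
    hF.intervalIntegrable_deriv.sub intervalIntegrable_const
  have hval : ∫ t in a..b, (deriv F t - c) = F b - F a - c * (b - a) := by
    rw [intervalIntegral.integral_sub hF.intervalIntegrable_deriv intervalIntegrable_const,
      hF.integral_deriv_eq_sub, intervalIntegral.integral_const, smul_eq_mul]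
    ring
  have hii : Integrable (fun t => deriv F t - c) (volume.restrict (Icc a b)) := by
    rw [intervalIntegrable_iff_integrableOn_Icc_of_le hab] at hint
    exact hint
  rw [← hval, intervalIntegral.integral_of_le hab, ← integral_Icc_eq_integral_Ioc]
  refine (ofReal_integral_le_lintegral hii).trans ?_
  unfold keplerAction
  refine lintegral_mono_ae ?_
  rw [ae_restrict_iff' measurableSet_Icc]
  filter_upwards [ae_differentiableAt_plane hx] with t ht htI
  have hdiff := ht (by rwa [uIcc_of_le hab])
  -- At a collision the action density is infinite, so the norm has to be differentiated only away
  -- from the origin.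
  rcases eq_or_ne (x t) 0 with h0 | h0
  · simp [h0]
  obtain ⟨h1, h2⟩ := abs_deriv_norm_le hdiff h0
  have hr : 0 < ‖x t‖ := norm_pos_iff.2 h0
  have hder : deriv F t = (√2 / √(‖x t‖ + e) + l * √(‖x t‖ + e)) * deriv (fun s => ‖x s‖) t :=
    ((hasDerivAt_calibrator l (by positivity)).comp t (h1.hasDerivAt.add_const e)).deriv
  have := calibration_pointwise (l := l) h2 hr he.le (by linarith [hd t htI] : _ ≤ d + e)
  rw [← hder] at this
  refine (ENNReal.ofReal_le_ofReal this).trans ?_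
  rw [ENNReal.ofReal_add (by positivity) (by positivity), ENNReal.ofReal_div_of_pos (by norm_num),
    ENNReal.ofReal_pow (norm_nonneg _), ofReal_norm, ENNReal.ofReal_inv_of_pos hr, ofReal_norm]
  simp

theorem calibration {x : ℝ → Plane} {a b d : ℝ} (hab : a ≤ b)
    (hx : AbsolutelyContinuousOnInterval x a b) (hd : ∀ t ∈ Icc a b, ‖x t‖ ≤ d) (l : ℝ) :
    ENNReal.ofReal (calibrator l ‖x b‖ - calibrator l ‖x a‖ -
      (√2 * l + l ^ 2 * d / 2) * (b - a)) ≤ keplerAction a b x := by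
  have hcont : Continuous fun e : ℝ => ENNReal.ofReal (calibrator l (‖x b‖ + e) -
      calibrator l (‖x a‖ + e) - (√2 * l + l ^ 2 * (d + e) / 2) * (b - a)) := by
    have := continuous_calibrator l
    refine ENNReal.continuous_ofReal.comp ?_
    fun_prop
  have ht : Tendsto _ (𝓝[>] (0 : ℝ)) _ := (hcont.tendsto 0).mono_left nhdsWithin_le_nhds
  simp only [add_zero] at ht
  refine le_of_tendsto ht ?_
  filter_upwards [self_mem_nhdsWithin] with e he
  exact calibration_shifted hab hx hd he l

/-! ### The radial parabolic arc and its action -/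

/-- The size of the parabolic motion at time one. -/
def parabolicConst : ℝ := (9 / 2 : ℝ) ^ (1 / 3 : ℝ)

theorem parabolicConst_pos : 0 < parabolicConst := by unfold parabolicConst; positivity

theorem parabolicConst_pow : parabolicConst ^ 3 = 9 / 2 := by
  unfold parabolicConst
  rw [← Real.rpow_natCast, ← Real.rpow_mul (by norm_num)]
  norm_num

/-- The outgoing parabolic motion in direction `e`. -/
def radial (e : Plane) (t : ℝ) : Plane := (parabolicConst * t ^ (2 / 3 : ℝ)) • e

theorem hasDerivAt_radial (e : Plane) {t : ℝ} (ht : 0 < t) :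
    HasDerivAt (radial e) ((parabolicConst * (2 / 3 * t ^ (-1 / 3 : ℝ))) • e) t := by
  have h := (Real.hasDerivAt_rpow_const (p := 2 / 3) (Or.inl ht.ne')).const_mul parabolicConst
  have h2 : (2 / 3 - 1 : ℝ) = -1 / 3 := by norm_num
  rw [h2] at h
  exact h.smul_const e

/-- The function is not Lipschitz at $0$, but it is the primitive of an integrable power. -/
theorem absolutelyContinuousOnInterval_rpow (τ : ℝ) :
    AbsolutelyContinuousOnInterval (fun t : ℝ => t ^ (2 / 3 : ℝ)) 0 τ := by
  have hi : IntervalIntegrable (fun t : ℝ => 2 / 3 * t ^ (-1 / 3 : ℝ)) volume 0 τ :=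
    (intervalIntegral.intervalIntegrable_rpow' (by norm_num)).const_mul _
  refine (hi.absolutelyContinuousOnInterval_intervalIntegral left_mem_uIcc).congr fun t _ => ?_
  simp only [intervalIntegral.integral_const_mul]
  rw [integral_rpow (Or.inl (by norm_num))]
  norm_num
  ring

theorem absolutelyContinuousOnInterval_radial (e : Plane) (τ : ℝ) :
    AbsolutelyContinuousOnInterval (radial e) 0 τ :=
  LipschitzOnWith.comp_absolutelyContinuousOnInterval (s := univ)
    (g := fun r : ℝ => (parabolicConst * r) • e) (K := ‖parabolicConst‖₊ * ‖e‖₊)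
    (LipschitzWith.lipschitzOnWith (LipschitzWith.of_dist_le_mul fun r r' => by
      rw [dist_eq_norm, ← sub_smul, ← mul_sub, norm_smul, norm_mul, Real.dist_eq]
      simp only [NNReal.coe_mul, coe_nnnorm, Real.norm_eq_abs]
      apply le_of_eq; ring))
    (absolutelyContinuousOnInterval_rpow τ) (mapsTo_univ _ _)

/-- The value $9/2$ of the cubed constant says that the energy is zero: kinetic and potential terms
are equal. -/
theorem radial_integrand {t : ℝ} (ht : 0 < t) :
    (parabolicConst * (2 / 3 * t ^ (-1 / 3 : ℝ))) ^ 2 / 2 + (parabolicConst * t ^ (2 / 3 : ℝ))⁻¹ =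
      2 / parabolicConst * t ^ (-2 / 3 : ℝ) := by
  have hc := parabolicConst_pos
  have h1 : (t ^ (-1 / 3 : ℝ)) ^ 2 = t ^ (-2 / 3 : ℝ) := by
    rw [← Real.rpow_natCast, ← Real.rpow_mul ht.le]; norm_num
  have h2 : (t ^ (2 / 3 : ℝ))⁻¹ = t ^ (-2 / 3 : ℝ) := by
    rw [← Real.rpow_neg ht.le]; norm_num
  rw [mul_inv, h2, mul_pow, mul_pow, h1]
  field_simp
  linear_combination 2 * parabolicConst_pow

/-- Expressed through the final radius, the cost of the arc is the calibrator with $l=0$; the lower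
bound is thus attained. -/
theorem radial_action_value {τ : ℝ} (hτ : 0 ≤ τ) :
    2 / parabolicConst * (3 * τ ^ (1 / 3 : ℝ)) =
      2 * √2 * √(parabolicConst * τ ^ (2 / 3 : ℝ)) := by
  have hc := parabolicConst_pos
  have h1 : (τ ^ (1 / 3 : ℝ)) ^ 2 = τ ^ (2 / 3 : ℝ) := by
    rw [← Real.rpow_natCast, ← Real.rpow_mul hτ]; norm_num
  refine (sq_eq_sq₀ (by positivity) (by positivity)).1 ?_
  have h2 : 0 ≤ parabolicConst * τ ^ (2 / 3 : ℝ) := by positivity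
  rw [mul_pow, mul_pow, mul_pow, mul_pow, Real.sq_sqrt zero_le_two, Real.sq_sqrt h2, h1]
  field_simp
  linear_combination (-2 * τ ^ (2 / 3 : ℝ)) * parabolicConst_pow

theorem keplerAction_radial {e : Plane} (he : ‖e‖ = 1) {τ : ℝ} (hτ : 0 ≤ τ) :
    keplerAction 0 τ (radial e) =
      ENNReal.ofReal (2 * √2 * √(parabolicConst * τ ^ (2 / 3 : ℝ))) := by
  have hc := parabolicConst_pos
  have hi : IntervalIntegrable (fun t : ℝ => 2 / parabolicConst * t ^ (-2 / 3 : ℝ)) volume 0 τ :=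
    (intervalIntegral.intervalIntegrable_rpow' (by norm_num)).const_mul _
  have hint : ∫ t in (0 : ℝ)..τ, 2 / parabolicConst * t ^ (-2 / 3 : ℝ) =
      2 * √2 * √(parabolicConst * τ ^ (2 / 3 : ℝ)) := by
    rw [← radial_action_value hτ, intervalIntegral.integral_const_mul,
      integral_rpow (Or.inl (by norm_num))]
    norm_num
    left; ring
  rw [← hint, intervalIntegral.integral_of_le hτ]
  unfold keplerAction
  rw [setLIntegral_congr Ioc_ae_eq_Icc.symm, ofReal_integral_eq_lintegral_ofReal
    ((intervalIntegrable_iff_integrableOn_Ioc_of_le hτ).1 hi)]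
  · refine setLIntegral_congr_fun measurableSet_Ioc fun t ht => ?_
    have ht0 : 0 < t := ht.1
    have hp : 0 < parabolicConst * t ^ (2 / 3 : ℝ) := by positivity
    rw [(hasDerivAt_radial e ht0).deriv, ← radial_integrand ht0, ENNReal.ofReal_add
      (by positivity) (by positivity), ENNReal.ofReal_div_of_pos (by norm_num),
      ENNReal.ofReal_pow (by positivity), ENNReal.ofReal_inv_of_pos hp, radial,
      ← ofReal_norm, ← ofReal_norm, norm_smul, norm_smul, he, mul_one, mul_one,
      Real.norm_of_nonneg (by positivity), Real.norm_of_nonneg hp.le]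
    simp
  · rw [EventuallyLE, ae_restrict_iff' measurableSet_Ioc]
    refine Eventually.of_forall fun t ht => ?_
    have : 0 < t := ht.1
    simp only [Pi.zero_apply]
    positivity

theorem parabolicConst_mul_rpow {s : ℝ} (hs : 0 < s)
    (h : (9 / 2 * s ^ 2) ^ (1 / 3 : ℝ) = 1) : parabolicConst * s ^ (2 / 3 : ℝ) = 1 := by
  rw [← h, Real.mul_rpow (by norm_num) (by positivity), parabolicConst, ← Real.rpow_natCast,
    ← Real.rpow_mul hs.le]
  norm_num

theorem sq_exitTime {s : ℝ} (hs : 0 < s) (h : (9 / 2 * s ^ 2) ^ (1 / 3 : ℝ) = 1) :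
    s = √2 / 3 := by
  have h1 : 9 / 2 * s ^ 2 = 1 := by
    have h2 : ((9 / 2 * s ^ 2) ^ (1 / 3 : ℝ)) ^ 3 = 9 / 2 * s ^ 2 := by
      rw [← Real.rpow_natCast, ← Real.rpow_mul (by positivity)]; norm_num
    rw [← h2, h, one_pow]
  refine (sq_eq_sq₀ hs.le (by positivity)).1 ?_
  rw [div_pow, Real.sq_sqrt (by norm_num)]
  linarith

theorem keplerAction_parabolic {u v : Plane} (hu : ‖u‖ = 1) (hv : ‖v‖ = 1) {s : ℝ} (hs : 0 < s)
    (h : (9 / 2 * s ^ 2) ^ (1 / 3 : ℝ) = 1) :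
    keplerAction (-s) s (parabolic u v) = ENNReal.ofReal (4 * √2) := by
  have h1 : keplerAction 0 s (parabolic u v) = keplerAction 0 s (radial v) :=
    keplerAction_congr fun t ht => by
      simp only [parabolic, radial, parabolicConst, abs_of_pos ht.1, if_pos ht.1.le]
  have h2 : keplerAction (-s) 0 (parabolic u v) = keplerAction 0 s (radial u) := by
    rw [keplerAction_congr (y := fun t => radial u (-t)), keplerAction_neg, neg_zero, neg_neg]
    intro t ht
    simp only [parabolic, radial, parabolicConst, abs_of_neg ht.2, if_neg (not_le.2 ht.2)]
  rw [keplerAction_add (b := 0) (by linarith) hs.le, h1, h2, keplerAction_radial hu hs.le,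
    keplerAction_radial hv hs.le, parabolicConst_mul_rpow hs h, Real.sqrt_one,
    ← ENNReal.ofReal_add (by positivity) (by positivity)]
  congr 1; ring

theorem eight_rpow_sixth : (8 : ℝ) ^ (1 / 6 : ℝ) = √2 := by
  rw [Real.sqrt_eq_rpow, show (8 : ℝ) = 2 ^ (3 : ℝ) by norm_num, ← Real.rpow_mul (by norm_num)]
  norm_num

/-! ### Upper bound by comparison with a radial arc -/

/-- `x` minimizes the action among all finite action paths on `[0, T]` from the origin to the
origin. -/
structure IsCollisionMinimizer (U : ℝ → Plane → ℝ) (T : ℝ) (x : ℝ → Plane) : Prop where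
  ac : AbsolutelyContinuousOnInterval x 0 T
  zero_left : x 0 = 0
  zero_right : x T = 0
  finite : keplerAction 0 T x ≠ ⊤
  minimal : ∀ y : ℝ → Plane, AbsolutelyContinuousOnInterval y 0 T → y 0 = 0 → y T = 0 →
    keplerAction 0 T y ≠ ⊤ → action U 0 T x ≤ action U 0 T y

theorem exists_potential_bounds {U : ℝ → Plane → ℝ} (hU : ContDiff ℝ 1 (Function.uncurry U))
    (T R : ℝ) : ∃ M L : ℝ, 0 ≤ M ∧ 0 ≤ L ∧
      (∀ t ∈ Icc 0 T, ∀ q : Plane, ‖q‖ ≤ R → |U t q| ≤ M) ∧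
      ∀ t ∈ Icc 0 T, ∀ t' ∈ Icc 0 T, ∀ q : Plane, ‖q‖ ≤ R → |U t q - U t' q| ≤ L * |t - t'| := by
  have hcpt : IsCompact (Icc 0 T ×ˢ Metric.closedBall (0 : Plane) R) :=
    isCompact_Icc.prod (isCompact_closedBall _ _)
  obtain ⟨M, hM⟩ := hcpt.exists_bound_of_continuousOn hU.continuous.continuousOn
  obtain ⟨L, hL⟩ := hU.contDiffOn.exists_lipschitzOnWith one_ne_zero
    ((convex_Icc 0 T).prod (convex_closedBall (0 : Plane) R)) hcpt
  refine ⟨max M 0, L, le_max_right _ _, L.2, fun t ht q hq => ?_, fun t ht t' ht' q hq => ?_⟩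
  · exact (hM (t, q) ⟨ht, by simpa using hq⟩).trans (le_max_left _ _)
  · have := hL.dist_le_mul (t, q) ⟨ht, by simpa using hq⟩ (t', q) ⟨ht', by simpa using hq⟩
    simpa [Function.uncurry, Real.dist_eq, Prod.dist_eq] using this

/-- The radial parabolic motion up to time `τ`, followed by the path `x` on `[s, T]`, run at constant
speed on `[τ, T]`. -/
def radialCompetitor (T s τ : ℝ) (x : ℝ → Plane) (e : Plane) (t : ℝ) : Plane :=
  if t ≤ τ then radial e t else x ((T - s) / (T - τ) * t + (T - (T - s) / (T - τ) * T))

theorem radialCompetitor_of_le {T s τ t : ℝ} (x : ℝ → Plane) (e : Plane) (h : t ≤ τ) :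
    radialCompetitor T s τ x e t = radial e t := if_pos h

theorem radialCompetitor_of_ge {T s τ t : ℝ} {x : ℝ → Plane} {e : Plane} (hτ : τ < T)
    (hxs : radial e τ = x s) (h : τ ≤ t) : radialCompetitor T s τ x e t =
      x ((T - s) / (T - τ) * t + (T - (T - s) / (T - τ) * T)) := by
  rcases h.eq_or_lt with rfl | h
  · rw [radialCompetitor_of_le _ _ le_rfl, hxs]
    congr 1
    have : T - τ ≠ 0 := by linarith
    field_simp
    ring
  · exact if_neg (not_le.2 h)

section Competitor

variable {T s τ : ℝ}

theorem competitor_time_left (hτ : τ < T) :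
    (T - s) / (T - τ) * τ + (T - (T - s) / (T - τ) * T) = s := by
  have : T - τ ≠ 0 := by linarith
  field_simp
  ring

theorem competitor_time_right :
    (T - s) / (T - τ) * T + (T - (T - s) / (T - τ) * T) = T := by ring

theorem absolutelyContinuousOnInterval_radialCompetitor {x : ℝ → Plane} {e : Plane}
    (hs : 0 ≤ s) (hsT : s < T) (hτ : 0 ≤ τ) (hτT : τ < T)
    (hx : AbsolutelyContinuousOnInterval x 0 T) (hxs : radial e τ = x s) :
    AbsolutelyContinuousOnInterval (radialCompetitor T s τ x e) 0 T := by
  refine AbsolutelyContinuousOnInterval.glue hτ hτT.le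
    ((absolutelyContinuousOnInterval_radial e τ).congr fun t ht => ?_) ?_
  · rw [uIcc_of_le hτ] at ht
    rw [radialCompetitor_of_le _ _ ht.2]
  have hk : 0 ≤ (T - s) / (T - τ) := div_nonneg (by linarith) (by linarith)
  refine (AbsolutelyContinuousOnInterval.comp_lipschitz (f := x)
    (φ := fun t => (T - s) / (T - τ) * t + (T - (T - s) / (T - τ) * T)) (K := ‖(T - s) / (T - τ)‖₊)
    (Or.inl fun u v h => by simpa using mul_le_mul_of_nonneg_left h hk)
    (LipschitzWith.of_dist_le_mul fun u v => by
      simp only [dist_add_right, Real.dist_eq, ← mul_sub, abs_mul]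
      simp [abs_div]) ?_).congr fun t ht => ?_
  · rw [competitor_time_left hτT, competitor_time_right]
    refine hx.mono ?_
    rw [uIcc_of_le hsT.le, uIcc_of_le (hs.trans hsT.le)]
    exact Icc_subset_Icc_left hs
  · rw [uIcc_of_le hτT.le] at ht
    rw [radialCompetitor_of_ge hτT hxs ht.1]

/-- As $s,\tau\le T/2$, both the speed ratio $(T-s)/(T-\tau)$ and its inverse are at most
$1+2(s+\tau)/T$. -/
theorem keplerAction_radialCompetitor_le {x : ℝ → Plane} {e : Plane} (he : ‖e‖ = 1)
    (hs : 0 ≤ s) (hsT : s ≤ T / 2) (hτ : 0 ≤ τ) (hτT : τ ≤ T / 2) (hT : 0 < T)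
    (hxs : radial e τ = x s) :
    keplerAction 0 T (radialCompetitor T s τ x e) ≤
      ENNReal.ofReal (2 * √2 * √(parabolicConst * τ ^ (2 / 3 : ℝ))) +
      ENNReal.ofReal (1 + 2 * (s + τ) / T) * keplerAction s T x := by
  have hτT' : τ < T := by linarith
  have hsp : 0 < T - s := by linarith
  have hτp : 0 < T - τ := by linarith
  rw [keplerAction_add hτ hτT'.le]
  refine add_le_add (le_of_eq ?_) ?_
  · rw [← keplerAction_radial he hτ]
    exact keplerAction_congr fun t ht => radialCompetitor_of_le _ _ ht.2.le
  · have h := keplerAction_affine_le (m := (T - s) / (T - τ)) (k := 1 + 2 * (s + τ) / T)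
      (by positivity) ?_ ?_ τ T (T - (T - s) / (T - τ) * T) x
    · rw [competitor_time_left hτT', competitor_time_right] at h
      refine le_trans (le_of_eq (keplerAction_congr fun t ht => ?_)) h
      exact radialCompetitor_of_ge hτT' hxs ht.1.le
    · rw [div_le_iff₀ hτp]
      have : T * ((1 + 2 * (s + τ) / T) * (T - τ)) = (T + 2 * (s + τ)) * (T - τ) := by
        field_simp
      nlinarith
    · rw [inv_div, div_le_iff₀ hsp]
      have : T * ((1 + 2 * (s + τ) / T) * (T - s)) = (T + 2 * (s + τ)) * (T - s) := by
        field_simp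
      nlinarith

/-- After time $\tau$ the competitor visits the points of $x$ at times displaced by at most
$s+\tau$, so only the Lipschitz constant of $U$ in time is needed. The loss collects $M\tau$ and
$Ms$ from the exchanged initial arcs, $LT(s+\tau)$ from the displacement and $M(s+\tau)$ from the
Jacobian. -/
theorem integral_radialCompetitor_le {U : ℝ → Plane → ℝ} (hU : Continuous (Function.uncurry U))
    {x : ℝ → Plane} {e : Plane} (he : ‖e‖ = 1) {R M L : ℝ} (hM : 0 ≤ M) (hL : 0 ≤ L)
    (hUM : ∀ t ∈ Icc 0 T, ∀ q : Plane, ‖q‖ ≤ R → |U t q| ≤ M)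
    (hUL : ∀ t ∈ Icc 0 T, ∀ t' ∈ Icc 0 T, ∀ q : Plane, ‖q‖ ≤ R → |U t q - U t' q| ≤ L * |t - t'|)
    (hx : AbsolutelyContinuousOnInterval x 0 T) (hxR : ∀ t ∈ Icc 0 T, ‖x t‖ ≤ R)
    (hs : 0 ≤ s) (hsT : s < T) (hτ : 0 ≤ τ) (hτT : τ < T) (hxs : radial e τ = x s) :
    ∫ t in 0..T, U t (radialCompetitor T s τ x e t) ≤
      (∫ t in 0..T, U t (x t)) + (2 * M + L * T) * (s + τ) := by
  set y := radialCompetitor T s τ x e with hy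
  set k := (T - s) / (T - τ) with hk
  set d := T - k * T with hd
  have hT : 0 ≤ T := hs.trans hsT.le
  have hsp : 0 < T - s := by linarith
  have hτp : 0 < T - τ := by linarith
  have hkp : 0 < k := by positivity
  have hyac := absolutelyContinuousOnInterval_radialCompetitor hs hsT hτ hτT hx hxs
  have hxc := hx.continuousOn
  have hyc := hyac.continuousOn
  rw [uIcc_of_le hT] at hxc hyc
  have hVx : ContinuousOn (fun t => U t (x t)) (Icc 0 T) :=
    hU.comp_continuousOn (continuousOn_id.prodMk hxc)
  have hVy : ContinuousOn (fun t => U t (y t)) (Icc 0 T) :=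
    hU.comp_continuousOn (continuousOn_id.prodMk hyc)
  have hIx : ∀ {a b}, 0 ≤ a → a ≤ b → b ≤ T →
      IntervalIntegrable (fun t => U t (x t)) volume a b := fun ha hab hb =>
    (hVx.mono (by rw [uIcc_of_le hab]; exact Icc_subset_Icc ha hb)).intervalIntegrable
  have hIy : ∀ {a b}, 0 ≤ a → a ≤ b → b ≤ T →
      IntervalIntegrable (fun t => U t (y t)) volume a b := fun ha hab hb =>
    (hVy.mono (by rw [uIcc_of_le hab]; exact Icc_subset_Icc ha hb)).intervalIntegrable
  have hφ : ∀ t ∈ Icc τ T, k * t + d ∈ Icc s T := by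
    intro t ht
    have h1 : k * τ + d = s := competitor_time_left hτT
    have h2 : k * T + d = T := competitor_time_right
    exact ⟨by nlinarith [ht.1], by nlinarith [ht.2]⟩
  have hyR : ∀ t ∈ Icc 0 τ, ‖y t‖ ≤ R := by
    intro t ht
    have hc := parabolicConst_pos
    rw [hy, radialCompetitor_of_le _ _ ht.2]
    refine le_trans ?_ (hxR s ⟨hs, hsT.le⟩)
    rw [← hxs, radial, radial, norm_smul, norm_smul, he, mul_one, mul_one,
      Real.norm_of_nonneg (by have := ht.1; positivity), Real.norm_of_nonneg (by positivity)]
    exact mul_le_mul_of_nonneg_left (Real.rpow_le_rpow ht.1 ht.2 (by norm_num)) hc.le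
  have e1 : ∫ t in 0..τ, U t (y t) ≤ M * τ := by
    have := intervalIntegral.norm_integral_le_of_norm_le_const (a := 0) (b := τ) (C := M)
      (f := fun t => U t (y t)) fun t ht => by
        rw [uIoc_of_le hτ] at ht
        exact hUM t ⟨ht.1.le, ht.2.trans hτT.le⟩ _ (hyR t ⟨ht.1.le, ht.2⟩)
    rw [sub_zero, abs_of_nonneg hτ] at this
    exact (le_abs_self _).trans this
  have e2 : -(M * s) ≤ ∫ t in 0..s, U t (x t) := by
    have := intervalIntegral.norm_integral_le_of_norm_le_const (a := 0) (b := s) (C := M)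
      (f := fun t => U t (x t)) fun t ht => by
        rw [uIoc_of_le hs] at ht
        exact hUM t ⟨ht.1.le, ht.2.trans hsT.le⟩ _ (hxR t ⟨ht.1.le, ht.2.trans hsT.le⟩)
    rw [sub_zero, abs_of_nonneg hs] at this
    exact (abs_le.1 this).1
  have hcomp : ContinuousOn (fun t => U (k * t + d) (x (k * t + d))) (Icc τ T) :=
    hVx.comp (f := fun t => k * t + d) (by fun_prop) fun t ht =>
      ⟨hs.trans (hφ t ht).1, (hφ t ht).2⟩
  have e3 : ∫ t in τ..T, U t (y t) ≤
      ∫ t in τ..T, (U (k * t + d) (x (k * t + d)) + L * (s + τ)) := by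
    refine intervalIntegral.integral_mono_on hτT.le (hIy hτ hτT.le le_rfl)
      (ContinuousOn.intervalIntegrable (by
        rw [uIcc_of_le hτT.le]; exact hcomp.add continuousOn_const)) fun t ht => ?_
    have hφt := hφ t ht
    rw [hy, radialCompetitor_of_ge hτT hxs ht.1]
    have h1 := hUL t ⟨hτ.trans ht.1, ht.2⟩ (k * t + d) ⟨hs.trans hφt.1, hφt.2⟩ _
      (hxR (k * t + d) ⟨hs.trans hφt.1, hφt.2⟩)
    have h2 : |t - (k * t + d)| ≤ s + τ := by
      have h4 : t - (k * t + d) = (k - 1) * (T - t) := by rw [hd]; ring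
      have h5 : (k - 1) * (T - τ) = τ - s := by rw [hk]; field_simp; ring
      have h6 : 0 ≤ T - t := by linarith [ht.2]
      have h7 : T - t ≤ T - τ := by linarith [ht.1]
      rw [h4, abs_mul, abs_of_nonneg h6]
      calc |k - 1| * (T - t) ≤ |k - 1| * (T - τ) := mul_le_mul_of_nonneg_left h7 (abs_nonneg _)
        _ = |τ - s| := by rw [← h5, abs_mul, abs_of_pos hτp]
        _ ≤ s + τ := by rw [abs_le]; constructor <;> linarith
    have := (le_abs_self _).trans (h1.trans (mul_le_mul_of_nonneg_left h2 hL))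
    linarith
  have e4 : ∫ t in τ..T, (U (k * t + d) (x (k * t + d)) + L * (s + τ)) =
      k⁻¹ * (∫ t in s..T, U t (x t)) + L * (s + τ) * (T - τ) := by
    rw [intervalIntegral.integral_add (ContinuousOn.intervalIntegrable (by
        rwa [uIcc_of_le hτT.le])) intervalIntegrable_const,
      intervalIntegral.integral_comp_mul_add (fun v => U v (x v)) hkp.ne',
      competitor_time_left hτT, competitor_time_right, intervalIntegral.integral_const]
    simp only [smul_eq_mul]
    ring
  have e5 : |∫ t in s..T, U t (x t)| ≤ M * (T - s) := by
    have := intervalIntegral.norm_integral_le_of_norm_le_const (a := s) (b := T) (C := M)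
      (f := fun t => U t (x t)) fun t ht => by
        rw [uIoc_of_le hsT.le] at ht
        exact hUM t ⟨hs.trans ht.1.le, ht.2⟩ _ (hxR t ⟨hs.trans ht.1.le, ht.2⟩)
    rwa [abs_of_pos hsp] at this
  have e6 : (k⁻¹ - 1) * (∫ t in s..T, U t (x t)) ≤ M * (s + τ) := by
    have h5 : (k⁻¹ - 1) * (T - s) = s - τ := by rw [hk]; field_simp; ring
    refine (le_abs_self _).trans ?_
    rw [abs_mul]
    calc |k⁻¹ - 1| * |∫ t in s..T, U t (x t)| ≤ |k⁻¹ - 1| * (M * (T - s)) :=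
          mul_le_mul_of_nonneg_left e5 (abs_nonneg _)
      _ = M * |s - τ| := by rw [← h5, abs_mul, abs_of_pos hsp]; ring
      _ ≤ M * (s + τ) := by
        refine mul_le_mul_of_nonneg_left ?_ hM
        rw [abs_le]; constructor <;> linarith
  have e7 := intervalIntegral.integral_add_adjacent_intervals (hIy le_rfl hτ hτT.le)
    (hIy hτ hτT.le le_rfl)
  have e8 := intervalIntegral.integral_add_adjacent_intervals (hIx le_rfl hs hsT.le)
    (hIx hs hsT.le le_rfl)
  have e9 : L * (s + τ) * (T - τ) ≤ L * (s + τ) * T :=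
    mul_le_mul_of_nonneg_left (by linarith) (by positivity)
  linarith

end Competitor

theorem action_eq_coe {U : ℝ → Plane → ℝ} {a b : ℝ} {x : ℝ → Plane} (h : keplerAction a b x ≠ ⊤) :
    action U a b x = (((keplerAction a b x).toReal + ∫ t in a..b, U t (x t) : ℝ) : EReal) := by
  rw [action, EReal.coe_add, EReal.coe_ennreal_toReal h]

theorem IsCollisionMinimizer.comparison {U : ℝ → Plane → ℝ} {T : ℝ} {x : ℝ → Plane} (hT : 0 < T)
    (hU : ContDiff ℝ 1 (Function.uncurry U)) (h : IsCollisionMinimizer U T x) :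
    ∃ C, 0 ≤ C ∧ ∀ s τ : ℝ, 0 < s → s ≤ T / 2 → 0 < τ → τ ≤ T / 2 →
      ‖x s‖ = parabolicConst * τ ^ (2 / 3 : ℝ) →
      (keplerAction 0 s x).toReal ≤ 2 * √2 * √‖x s‖ + C * (s + τ) := by
  obtain ⟨R, hR⟩ := h.ac.exists_bound
  rw [uIcc_of_le hT.le] at hR
  obtain ⟨M, L, hM, hL, hUM, hUL⟩ := exists_potential_bounds hU T R
  have hA : 0 ≤ (keplerAction 0 T x).toReal := ENNReal.toReal_nonneg
  -- The first summand pays for the change of speed in the Kepler action, the second for the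
  -- potential.
  refine ⟨2 * (keplerAction 0 T x).toReal / T + (2 * M + L * T), by positivity,
    fun s τ hs hsT hτ hτT hxs => ?_⟩
  have hc := parabolicConst_pos
  have hpos : 0 < ‖x s‖ := by rw [hxs]; positivity
  set e : Plane := ‖x s‖⁻¹ • x s with he
  have he1 : ‖e‖ = 1 := by
    rw [he, norm_smul, norm_inv, norm_norm, inv_mul_cancel₀ hpos.ne']
  have hrad : radial e τ = x s := by
    rw [radial, ← hxs, he, smul_smul, mul_inv_cancel₀ hpos.ne', one_smul]
  have hsT' : s < T := by linarith
  have hτT' : τ < T := by linarith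
  have hsplit := keplerAction_add hs.le hsT'.le x
  have hf1 : keplerAction 0 s x ≠ ⊤ := fun h' => h.finite (by rw [hsplit, h', top_add])
  have hf2 : keplerAction s T x ≠ ⊤ := fun h' => h.finite (by rw [hsplit, h', add_top])
  have hK := keplerAction_radialCompetitor_le he1 hs.le hsT hτ.le hτT hT hrad
  have hfy : keplerAction 0 T (radialCompetitor T s τ x e) ≠ ⊤ :=
    ne_top_of_le_ne_top (by finiteness) hK
  have hmin := h.minimal _ (absolutelyContinuousOnInterval_radialCompetitor hs.le hsT' hτ.le hτT'
    h.ac hrad) (by simp [radialCompetitor_of_le _ _ hτ.le, radial])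
    (by rw [radialCompetitor_of_ge hτT' hrad hτT'.le, competitor_time_right, h.zero_right]) hfy
  rw [action_eq_coe h.finite, action_eq_coe hfy, EReal.coe_le_coe_iff] at hmin
  have hpot := integral_radialCompetitor_le hU.continuous he1 hM hL hUM hUL h.ac hR hs.le hsT' hτ.le
    hτT' hrad
  have hKr := ENNReal.toReal_mono (by finiteness) hK
  rw [ENNReal.toReal_add (by finiteness) (by finiteness), ENNReal.toReal_mul,
    ENNReal.toReal_ofReal (by positivity), ENNReal.toReal_ofReal (by positivity), ← hxs] at hKr
  have hsr := congrArg ENNReal.toReal hsplit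
  rw [ENNReal.toReal_add hf1 hf2] at hsr
  have hb : (keplerAction s T x).toReal ≤ (keplerAction 0 T x).toReal := by
    have : 0 ≤ (keplerAction 0 s x).toReal := ENNReal.toReal_nonneg
    linarith
  have h9 : 2 * (s + τ) / T * (keplerAction s T x).toReal ≤
      2 * (keplerAction 0 T x).toReal / T * (s + τ) := by
    calc _ ≤ 2 * (s + τ) / T * (keplerAction 0 T x).toReal :=
          mul_le_mul_of_nonneg_left hb (by positivity)
      _ = _ := by ring
  linarith

/-! ### From loops to paths that start and end in collision -/

theorem action_congr {U : ℝ → Plane → ℝ} {a b : ℝ} {x y : ℝ → Plane} (hab : a ≤ b)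
    (h : EqOn x y (Icc a b)) : action U a b x = action U a b y := by
  unfold action
  rw [keplerAction_congr (h.mono Ioo_subset_Icc_self), intervalIntegral.integral_congr]
  intro t ht
  rw [uIcc_of_le hab] at ht
  simp only [h ht]

theorem action_const_add (U : ℝ → Plane → ℝ) (a b c : ℝ) (x : ℝ → Plane) :
    action (fun t => U (c + t)) a b (fun t => x (c + t)) = action U (c + a) (c + b) x := by
  unfold action
  rw [keplerAction_const_add, intervalIntegral.integral_comp_add_left (fun t => U t (x t))]

theorem action_neg (U : ℝ → Plane → ℝ) (a b : ℝ) (x : ℝ → Plane) :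
    action (fun t => U (-t)) a b (fun t => x (-t)) = action U (-b) (-a) x := by
  unfold action
  rw [keplerAction_neg, intervalIntegral.integral_comp_neg (fun t => U t (x t))]

theorem action_periodic {U : ℝ → Plane → ℝ} {T : ℝ} {x : ℝ → Plane} (hT : 0 < T)
    (hU : ∀ t q, U (t + T) q = U t q) (hx : Function.Periodic x T) (a b : ℝ) :
    action U a (a + T) x = action U b (b + T) x := by
  have hp : Function.Periodic (fun t => U t (x t)) T := fun t => by simp only [hU, hx t]
  unfold action
  rw [keplerAction_periodic hT hx a b, hp.intervalIntegral_add_eq a b]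

/-- The circular loop run once over a period. -/
def circularLoop (T t : ℝ) : Plane :=
  !₂[Real.cos (2 * Real.pi / T * t), Real.sin (2 * Real.pi / T * t)]

theorem norm_circularLoop (T t : ℝ) : ‖circularLoop T t‖ = 1 := by
  rw [EuclideanSpace.norm_eq]
  simp [circularLoop]

theorem contDiff_circularLoop (T : ℝ) : ContDiff ℝ 1 (circularLoop T) := by
  rw [contDiff_euclidean]
  intro i
  fin_cases i <;> simp only [circularLoop] <;> simp <;> fun_prop

theorem keplerAction_circularLoop_ne_top (T : ℝ) : keplerAction 0 T (circularLoop T) ≠ ⊤ := by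
  obtain ⟨B, hB⟩ := isCompact_Icc.exists_bound_of_continuousOn (s := Icc 0 T)
    ((contDiff_circularLoop T).continuous_deriv le_rfl).continuousOn
  have h1 : keplerAction 0 T (circularLoop T) ≤
      ∫⁻ _ in Icc 0 T, (ENNReal.ofReal B ^ 2 / 2 + 1) := by
    refine setLIntegral_mono measurable_const fun t ht => ?_
    have h2 : ‖circularLoop T t‖ₑ = 1 := by rw [← ofReal_norm, norm_circularLoop]; simp
    rw [h2, inv_one, ← ofReal_norm]
    gcongr
    exact hB t ht
  refine ne_top_of_le_ne_top ?_ h1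
  rw [setLIntegral_const, Real.volume_Icc]
  finiteness

theorem circularLoop_mem {T : ℝ} (hT : 0 < T) : circularLoop T ∈ windingLoops T := by
  have hπ := Real.pi_pos
  refine ⟨⟨fun t => ?_, (contDiff_circularLoop T).contDiffOn.absolutelyContinuousOnInterval,
    memLp_deriv_of_keplerAction (keplerAction_circularLoop_ne_top T)⟩, fun t _ h => ?_,
    fun t => 2 * Real.pi / T * t, ⟨by fun_prop, fun t _ => ?_⟩, ?_⟩
  · have : 2 * Real.pi / T * (t + T) = 2 * Real.pi / T * t + 2 * Real.pi := by field_simp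
    simp only [circularLoop, this, Real.cos_add_two_pi, Real.sin_add_two_pi]
  · have := norm_circularLoop T t
    rw [h, norm_zero] at this
    exact zero_ne_one this
  · rw [norm_circularLoop, one_smul]; rfl
  · have := hT.ne'
    field_simp
    simpa

/-- `x` is a collision loop of finite action which minimizes the action among the collision loops
of finite action. -/
structure IsLoopMinimizer (U : ℝ → Plane → ℝ) (T : ℝ) (x : ℝ → Plane) : Prop where
  periodic : Function.Periodic x T
  ac : AbsolutelyContinuousOnInterval x 0 T
  finite : keplerAction 0 T x ≠ ⊤
  minimal : ∀ y : ℝ → Plane, Function.Periodic y T → AbsolutelyContinuousOnInterval y 0 T →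
    (∃ t ∈ Icc 0 T, y t = 0) → keplerAction 0 T y ≠ ⊤ → action U 0 T x ≤ action U 0 T y

/-- The circular loop is admissible and has finite action, hence so does the minimizer. Winding
loops serve no other purpose; all later competitors are collision loops. -/
theorem IsActionMinimizer.isLoopMinimizer {U : ℝ → Plane → ℝ} {T : ℝ} {x : ℝ → Plane} (hT : 0 < T)
    (h : IsActionMinimizer U T x) : IsLoopMinimizer U T x := by
  have hloop : SobolevLoop T x := h.1.elim And.left And.left
  refine ⟨hloop.1, hloop.2.1, fun htop => ?_, fun y hp hac h0 hf =>
    h.2 y (Or.inl ⟨⟨hp, hac, memLp_deriv_of_keplerAction hf⟩, h0⟩)⟩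
  have := h.2 _ (Or.inr (circularLoop_mem hT))
  rw [action_eq_coe (keplerAction_circularLoop_ne_top T), action, htop, EReal.coe_ennreal_top,
    EReal.top_add_coe, top_le_iff] at this
  exact EReal.coe_ne_top _ this

section LoopMinimizer

variable {U : ℝ → Plane → ℝ} {T : ℝ} {x : ℝ → Plane}

theorem IsLoopMinimizer.ac_add (hT : 0 < T) (h : IsLoopMinimizer U T x) (a : ℝ) :
    AbsolutelyContinuousOnInterval x a (a + T) :=
  AbsolutelyContinuousOnInterval.of_periodic hT h.periodic (a := 0) (by simpa using h.ac) a

theorem IsLoopMinimizer.finite_add (hT : 0 < T) (h : IsLoopMinimizer U T x) (a : ℝ) :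
    keplerAction a (a + T) x ≠ ⊤ := by
  rw [keplerAction_periodic hT h.periodic a 0, zero_add]
  exact h.finite

theorem IsLoopMinimizer.continuous (hT : 0 < T) (h : IsLoopMinimizer U T x) : Continuous x := by
  rw [continuous_iff_continuousAt]
  intro t
  have := (h.ac_add hT (t - T / 2)).continuousOn
  rw [uIcc_of_le (by linarith)] at this
  exact this.continuousAt (Icc_mem_nhds (by linarith) (by linarith))

theorem IsLoopMinimizer.reverse (hT : 0 < T) (hU : ∀ t q, U (t + T) q = U t q)
    (h : IsLoopMinimizer U T x) : IsLoopMinimizer (fun t => U (-t)) T (fun t => x (-t)) := by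
  have hper : ∀ {y : ℝ → Plane}, Function.Periodic y T → Function.Periodic (fun t => y (-t)) T :=
    fun hy t => by
      have := hy (-(t + T))
      simp only at this ⊢
      rw [← this]; congr 1; ring
  have hac : ∀ {y : ℝ → Plane}, Function.Periodic y T → AbsolutelyContinuousOnInterval y 0 T →
      AbsolutelyContinuousOnInterval (fun t => y (-t)) 0 T := fun hy h0 => by
    refine AbsolutelyContinuousOnInterval.comp_neg ?_
    have := AbsolutelyContinuousOnInterval.of_periodic hT hy (a := 0) (by simpa using h0) (-T)
    rw [neg_add_cancel] at this
    simpa using this.symm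
  have hk : ∀ {y : ℝ → Plane}, Function.Periodic y T →
      keplerAction 0 T (fun t => y (-t)) = keplerAction 0 T y := fun hy => by
    have := keplerAction_periodic hT hy (-T) 0
    rw [neg_add_cancel, zero_add] at this
    rw [keplerAction_neg, neg_zero, this]
  have hA : ∀ {y : ℝ → Plane}, Function.Periodic y T →
      action (fun t => U (-t)) 0 T (fun t => y (-t)) = action U 0 T y := fun hy => by
    have := action_periodic hT hU hy (-T) 0
    rw [neg_add_cancel, zero_add] at this
    rw [action_neg, neg_zero, this]
  refine ⟨hper h.periodic, hac h.periodic h.ac, by rw [hk h.periodic]; exact h.finite,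
    fun y hy hyac ⟨t, ht, h0⟩ hf => ?_⟩
  rw [hA h.periodic]
  have e : action (fun t => U (-t)) 0 T y = action U 0 T (fun t => y (-t)) := by
    rw [← hA (hper hy)]; simp only [neg_neg]
  rw [e]
  refine h.minimal _ (hper hy) (hac hy hyac) ⟨T - t, ⟨by linarith [ht.2], by linarith [ht.1]⟩, ?_⟩
    (by rw [hk hy]; exact hf)
  rw [← h0, ← hy (-(T - t))]
  congr 1; ring

/-- A path from the origin to the origin closes up to a loop; translated by $t_0$ it still collides
at $t_0$, so it competes with $x$. -/
theorem IsLoopMinimizer.isCollisionMinimizer (hT : 0 < T) (hU : ∀ t q, U (t + T) q = U t q)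
    (h : IsLoopMinimizer U T x) {t₀ : ℝ} (ht₀ : t₀ ∈ Icc 0 T) (hcol : x t₀ = 0) :
    IsCollisionMinimizer (fun t => U (t₀ + t)) T (fun t => x (t₀ + t)) := by
  refine ⟨AbsolutelyContinuousOnInterval.comp_const_add (by simpa using h.ac_add hT t₀), by simpa,
    by simpa [h.periodic t₀], ?_, fun y hac h0 hyT hf => ?_⟩
  · rw [keplerAction_const_add, add_zero]
    exact h.finite_add hT t₀
  set Z : ℝ → Plane := fun t => y (toIcoMod hT 0 t) with hZ
  have hZp : Function.Periodic Z T := fun t => by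
    simp only [hZ, toIcoMod_add_right]
  -- The endpoint $T$ is included because $y$ vanishes at both ends.
  have hZy : EqOn y Z (Icc 0 T) := by
    intro t ht
    rcases ht.2.eq_or_lt with rfl | h1
    · have := hZp 0
      rw [zero_add] at this
      rw [hyT, this, hZ]
      simp [toIcoMod_apply_left, h0]
    · have : toIcoMod hT 0 t = t := (toIcoMod_eq_self hT).2 ⟨ht.1, by simpa using h1⟩
      simp only [hZ, this]
  have hYp : Function.Periodic (fun t => Z (-t₀ + t)) T := fun t => by
    have := hZp (-t₀ + t)
    simp only at this ⊢
    rw [← this, add_assoc]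
  have hYac : AbsolutelyContinuousOnInterval (fun t => Z (-t₀ + t)) 0 T := by
    refine AbsolutelyContinuousOnInterval.comp_const_add ?_
    have := AbsolutelyContinuousOnInterval.of_periodic hT hZp (a := 0)
      (by simpa using hac.congr (by rwa [uIcc_of_le hT.le])) (-t₀)
    simpa using this
  have hYK : keplerAction 0 T (fun t => Z (-t₀ + t)) ≠ ⊤ := by
    have := keplerAction_periodic hT hZp (-t₀) 0
    rw [zero_add] at this
    rw [keplerAction_const_add, add_zero, this,
      ← keplerAction_congr (hZy.mono Ioo_subset_Icc_self)]
    exact hf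
  have hmin := h.minimal _ hYp hYac ⟨t₀, ht₀, by
    rw [neg_add_cancel, ← hZy ⟨le_rfl, hT.le⟩, h0]⟩ hYK
  have e1 := action_periodic hT hU h.periodic t₀ 0
  have e2 := action_periodic hT hU hYp t₀ 0
  have e3 := action_const_add U 0 T t₀ x
  have e4 := action_const_add U 0 T t₀ (fun t => Z (-t₀ + t))
  simp only [neg_add_cancel_left, zero_add, add_zero] at e1 e2 e3 e4
  rw [e3, e1, action_congr hT.le hZy, e4, e2]
  exact hmin

end LoopMinimizer

/-! ### Exit times and their asymptotics -/

theorem exists_first_hit {f : ℝ → ℝ} (hf : Continuous f) {d t : ℝ} (ht : 0 < t) (h0 : f 0 < d)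
    (hd : d ≤ f t) : ∃ s, 0 < s ∧ f s = d ∧ ∀ r ∈ Ico 0 s, f r < d := by
  obtain ⟨s, ⟨hs, hds⟩, hleast⟩ := (isCompact_Icc.inter_right (isClosed_le continuous_const hf) :
    IsCompact (Icc 0 t ∩ {r | d ≤ f r})).exists_isLeast ⟨t, ⟨ht.le, le_rfl⟩, hd⟩
  have hlt : ∀ r ∈ Ico 0 s, f r < d := fun r hr => by
    by_contra hc
    exact absurd (hleast ⟨⟨hr.1, hr.2.le.trans hs.2⟩, not_lt.1 hc⟩) (not_le.2 hr.2)
  have hs0 : 0 < s := hs.1.lt_of_ne fun h => by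
    rw [← h] at hds
    exact absurd hds (not_le.2 h0)
  refine ⟨s, hs0, ?_, hlt⟩
  obtain ⟨r, hr, hrd⟩ := intermediate_value_Icc hs.1 hf.continuousOn ⟨h0.le, hds⟩
  rcases hr.2.eq_or_lt with rfl | h
  · exact hrd
  · exact absurd hrd (hlt r ⟨hr.1, h⟩).ne

theorem IsExitTimes.unique {x : ℝ → Plane} {t₀ δ r s r' s' : ℝ} (h : IsExitTimes x t₀ δ r s)
    (h' : IsExitTimes x t₀ δ r' s') : r = r' ∧ s = s' := by
  have h1 := h.left_pos
  have h2 := h.right_pos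
  have h1' := h'.left_pos
  have h2' := h'.right_pos
  constructor
  · rcases lt_trichotomy r r' with hl | hl | hl
    · exact absurd h.norm_left (h'.norm_lt _ ⟨by linarith, by linarith⟩).ne
    · exact hl
    · exact absurd h'.norm_left (h.norm_lt _ ⟨by linarith, by linarith⟩).ne
  · rcases lt_trichotomy s s' with hl | hl | hl
    · exact absurd h.norm_right (h'.norm_lt _ ⟨by linarith, by linarith⟩).ne
    · exact hl
    · exact absurd h'.norm_right (h.norm_lt _ ⟨by linarith, by linarith⟩).ne

theorem exists_ne_zero_of_keplerAction {a b : ℝ} (hab : a < b) {x : ℝ → Plane}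
    (h : keplerAction a b x ≠ ⊤) : ∃ t ∈ Ioo a b, x t ≠ 0 := by
  by_contra! hc
  refine h ?_
  rw [keplerAction_congr (y := fun _ => 0) fun t ht => hc t ht]
  simp [keplerAction, ENNReal.top_mul, hab]

theorem exists_isExitTimes {x : ℝ → Plane} (hx : Continuous x) {t₀ δ r s : ℝ} (h0 : x t₀ = 0)
    (hδ : 0 < δ) (hr : 0 < r) (hs : 0 < s) (hδr : δ ≤ ‖x (t₀ - r)‖) (hδs : δ ≤ ‖x (t₀ + s)‖) :
    ∃! p : ℝ × ℝ, IsExitTimes x t₀ δ p.1 p.2 := by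
  obtain ⟨s', hs', hse, hsl⟩ := exists_first_hit (f := fun t => ‖x (t₀ + t)‖) (by fun_prop) hs
    (by simpa [h0]) hδs
  obtain ⟨r', hr', hre, hrl⟩ := exists_first_hit (f := fun t => ‖x (t₀ - t)‖) (by fun_prop) hr
    (by simpa [h0]) hδr
  have hexit : IsExitTimes x t₀ δ r' s' := ⟨hr', hs', hre, hse, fun t ht => by
    rcases le_total t₀ t with h | h
    · simpa using hsl (t - t₀) ⟨by linarith, by linarith [ht.2]⟩
    · simpa using hrl (t₀ - t) ⟨by linarith, by linarith [ht.1]⟩⟩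
  refine ⟨(r', s'), hexit, fun p hp => ?_⟩
  obtain ⟨h1, h2⟩ := hp.unique hexit
  exact Prod.ext h1 h2

/-- The left side is linear in $\mu$ and the right side quadratic up to a vanishing error, so small
$\mu$ of either sign bounds $s_0-\sigma$ from one side. -/
theorem tendsto_of_calibrated {σ : ℝ → ℝ} {s₀ C : ℝ} (hs₀ : 0 < s₀) (hC : 0 ≤ C)
    (h : ∀ᶠ δ in 𝓝[>] (0 : ℝ), 0 ≤ σ δ ∧
      ∀ μ : ℝ, √2 * μ * (s₀ - σ δ) ≤ μ ^ 2 / 2 * σ δ + C * δ * (σ δ + s₀)) :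
    Tendsto σ (𝓝[>] 0) (𝓝 s₀) := by
  have h2 : (1.4 : ℝ) ≤ √2 := Real.le_sqrt_of_sq_le (by norm_num)
  have h2' : √2 ≤ (1.5 : ℝ) := Real.sqrt_le_iff.2 ⟨by norm_num, by norm_num⟩
  rw [Metric.tendsto_nhds]
  intro ε hε
  have hsmall : ∀ c : ℝ, 0 < c → ∀ᶠ δ in 𝓝[>] (0 : ℝ), C * δ < c := fun c hc => by
    have ht : Tendsto (fun δ : ℝ => C * δ) (𝓝[>] 0) (𝓝 (C * 0)) :=
      ((continuous_const_mul C).tendsto 0).mono_left nhdsWithin_le_nhds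
    rw [mul_zero] at ht
    exact ht.eventually_lt_const hc
  -- With $\sigma\le3s_0$ this choice makes the quadratic term at $\mu=\pm\rho$ at most
  -- $\rho\varepsilon/2$, leaving $\rho\varepsilon/2$ for the error.
  set ρ := ε / (3 * s₀) with hρ
  have hρ0 : 0 < ρ := by positivity
  have hρe : 3 * s₀ * ρ = ε := by rw [hρ]; field_simp
  filter_upwards [h, hsmall (1 / 4) (by norm_num), hsmall (ρ * ε / (8 * s₀)) (by positivity),
    self_mem_nhdsWithin] with δ ⟨hσ, hμ⟩ hδ1 hδ2 hδ0
  have hδp : 0 ≤ C * δ := mul_nonneg hC (le_of_lt hδ0)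
  -- The value $\mu=-1$ works because $\sqrt2>\tfrac12+\tfrac14$.
  have hσb : σ δ ≤ 3 * s₀ := by
    have := hμ (-1)
    nlinarith [mul_le_mul_of_nonneg_right hδ1.le (by positivity : 0 ≤ σ δ + s₀)]
  have he : C * δ * (σ δ + s₀) < ρ * ε / 2 := by
    have h3 : C * δ * (4 * s₀) < ρ * ε / (8 * s₀) * (4 * s₀) :=
      mul_lt_mul_of_pos_right hδ2 (by positivity)
    have h4 : ρ * ε / (8 * s₀) * (4 * s₀) = ρ * ε / 2 := by field_simp; norm_num
    nlinarith
  have hq : ρ ^ 2 / 2 * σ δ ≤ ρ * ε / 2 := by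
    have : ρ ^ 2 / 2 * σ δ ≤ ρ ^ 2 / 2 * (3 * s₀) := mul_le_mul_of_nonneg_left hσb (by positivity)
    nlinarith
  have key : ∀ z : ℝ, √2 * ρ * z < ρ * ε → z < ε := fun z hz => by
    by_contra! hc
    nlinarith [mul_le_mul_of_nonneg_left hc hρ0.le, mul_nonneg hρ0.le (hε.le.trans hc)]
  have k1 := key (s₀ - σ δ) (by linarith [hμ ρ])
  have k2 := key (σ δ - s₀) (by have := hμ (-ρ); rw [neg_sq] at this; linarith)
  rw [Real.dist_eq, abs_lt]
  constructor <;> linarith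

section ExitTimes

variable {U : ℝ → Plane → ℝ} {T : ℝ} {x : ℝ → Plane}

/-- A crude a priori bound: it makes exit times small enough for the comparison, which requires
$s\le T/2$. -/
theorem IsCollisionMinimizer.exit_le (hT : 0 < T) (h : IsCollisionMinimizer U T x) :
    ∀ᶠ δ in 𝓝[>] (0 : ℝ), ∀ s : ℝ, 0 < s → ‖x s‖ = δ → (∀ t ∈ Ioo 0 s, ‖x t‖ < δ) →
      s ≤ T ∧ s ≤ 2 * (keplerAction 0 T x).toReal * δ := by
  obtain ⟨t₁, ht₁, hne⟩ := exists_ne_zero_of_keplerAction hT h.finite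
  have hev : ∀ᶠ δ in 𝓝[>] (0 : ℝ), δ < ‖x t₁‖ :=
    (eventually_lt_nhds (norm_pos_iff.2 hne)).filter_mono nhdsWithin_le_nhds
  filter_upwards [hev, self_mem_nhdsWithin] with δ hδ hδ0 s hs hxs hlt
  have hδ0' : 0 < δ := hδ0
  have hst : s ≤ t₁ := by
    by_contra! hc
    exact absurd (hlt t₁ ⟨ht₁.1, hc⟩) (not_lt.2 hδ.le)
  have hsT : s ≤ T := hst.trans ht₁.2.le
  refine ⟨hsT, ?_⟩
  have hle : ∀ t ∈ Icc 0 s, ‖x t‖ ≤ δ := fun t ht => by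
    rcases ht.1.eq_or_lt with rfl | h1
    · rw [h.zero_left, norm_zero]; exact hδ0'.le
    rcases ht.2.eq_or_lt with rfl | h2
    · exact hxs.le
    · exact (hlt t ⟨h1, h2⟩).le
  have hac : AbsolutelyContinuousOnInterval x 0 s := h.ac.mono (by
    rw [uIcc_of_le hs.le, uIcc_of_le hT.le]; exact Icc_subset_Icc_right hsT)
  have hK : keplerAction 0 s x ≤ keplerAction 0 T x := by
    rw [keplerAction_add hs.le hsT]; exact le_self_add
  -- A negative slope of size $1/\delta$ turns the length term into the positive quantity
  -- $(\sqrt2-\tfrac12)s/\delta$, bounded by the total action.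
  have := (calibration hs.le hac hle (-δ⁻¹)).trans hK
  rw [ENNReal.ofReal_le_iff_le_toReal h.finite, h.zero_left, hxs, norm_zero] at this
  simp only [calibrator, Real.sqrt_zero] at this
  have h3 : √δ ^ 3 = δ * √δ := by rw [pow_succ, Real.sq_sqrt hδ0'.le]
  have e1 : 2 / 3 * -δ⁻¹ * √δ ^ 3 = -(2 / 3) * √δ := by rw [h3]; field_simp
  have e2 : (√2 * -δ⁻¹ + (-δ⁻¹) ^ 2 * δ / 2) * (s - 0) = -((√2 - 1 / 2) * (s / δ)) := by
    field_simp; ring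
  rw [e1, e2] at this
  have h2 : (1 : ℝ) ≤ √2 := Real.one_le_sqrt.2 (by norm_num)
  have h5 : 0 ≤ √δ := Real.sqrt_nonneg _
  have h6 : 0 ≤ s / δ := by positivity
  have h7 : s / δ ≤ 2 * (keplerAction 0 T x).toReal := by nlinarith
  rwa [div_le_iff₀ hδ0'] at h7

theorem IsCollisionMinimizer.tendsto_exit (hT : 0 < T) (hU : ContDiff ℝ 1 (Function.uncurry U))
    (h : IsCollisionMinimizer U T x) {s₀ : ℝ} (hs₀ : 0 < s₀)
    (hs₀' : (9 / 2 * s₀ ^ 2) ^ (1 / 3 : ℝ) = 1) {e : ℝ → ℝ}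
    (he : ∀ᶠ δ in 𝓝[>] (0 : ℝ), 0 < e δ ∧ ‖x (e δ)‖ = δ ∧ ∀ t ∈ Ioo 0 (e δ), ‖x t‖ < δ) :
    Tendsto (fun δ => e δ / δ ^ (3 / 2 : ℝ)) (𝓝[>] 0) (𝓝 s₀) := by
  obtain ⟨C, hC, hcomp⟩ := h.comparison hT hU
  refine tendsto_of_calibrated hs₀ hC ?_
  have hsmall : ∀ᶠ δ in 𝓝[>] (0 : ℝ), 2 * (keplerAction 0 T x).toReal * δ < T / 2 := by
    have ht : Tendsto (fun δ : ℝ => 2 * (keplerAction 0 T x).toReal * δ) (𝓝[>] 0) (𝓝 (_ * 0)) :=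
      ((continuous_const_mul _).tendsto 0).mono_left nhdsWithin_le_nhds
    rw [mul_zero] at ht
    exact ht.eventually_lt_const (by positivity)
  have hsmall' : ∀ᶠ δ in 𝓝[>] (0 : ℝ), s₀ * δ ^ (3 / 2 : ℝ) < T / 2 := by
    have hc : Continuous fun δ : ℝ => s₀ * δ ^ (3 / 2 : ℝ) :=
      continuous_const.mul (Real.continuous_rpow_const (by norm_num))
    have ht : Tendsto (fun δ : ℝ => s₀ * δ ^ (3 / 2 : ℝ)) (𝓝[>] 0) (𝓝 _) :=
      (hc.tendsto 0).mono_left nhdsWithin_le_nhds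
    rw [Real.zero_rpow (by norm_num), mul_zero] at ht
    exact ht.eventually_lt_const (by positivity)
  filter_upwards [he, h.exit_le hT, hsmall, hsmall', self_mem_nhdsWithin] with
    δ ⟨hs, hxs, hlt⟩ hexit hδ1 hδ2 hδ0
  have hδ : 0 < δ := hδ0
  obtain ⟨hsT, hsA⟩ := hexit _ hs hxs hlt
  set s := e δ with hse
  have hsq : 0 < √δ := Real.sqrt_pos.2 hδ
  have h32 : δ ^ (3 / 2 : ℝ) = δ * √δ := by
    rw [Real.sqrt_eq_rpow, ← Real.rpow_one_add' hδ.le (by norm_num)]; norm_num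
  -- By homogeneity, $s_0\delta^{3/2}$ is the time at which the parabolic motion reaches radius
  -- $\delta$.
  have hτ : ‖x s‖ = parabolicConst * (s₀ * δ ^ (3 / 2 : ℝ)) ^ (2 / 3 : ℝ) := by
    rw [Real.mul_rpow hs₀.le (by positivity), ← mul_assoc, parabolicConst_mul_rpow hs₀ hs₀',
      ← Real.rpow_mul hδ.le, hxs]
    norm_num
  have hup := hcomp s (s₀ * δ ^ (3 / 2 : ℝ)) hs (by linarith) (by positivity) hδ2.le hτ
  have hle : ∀ t ∈ Icc 0 s, ‖x t‖ ≤ δ := fun t ht => by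
    rcases ht.1.eq_or_lt with rfl | h1
    · rw [h.zero_left, norm_zero]; exact hδ.le
    rcases ht.2.eq_or_lt with h2 | h2
    · rw [h2]; exact hxs.le
    · exact (hlt t ⟨h1, h2⟩).le
  have hac : AbsolutelyContinuousOnInterval x 0 s := h.ac.mono (by
    rw [uIcc_of_le hs.le, uIcc_of_le hT.le]; exact Icc_subset_Icc_right hsT)
  have hfin : keplerAction 0 s x ≠ ⊤ := fun h' => h.finite (by
    rw [keplerAction_add hs.le hsT, h', top_add])
  refine ⟨by positivity, fun μ => ?_⟩
  -- With slope $\mu/\delta$ every term of the lower bound scales like $\sqrt\delta$, and the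
  -- leading term $2\sqrt2\sqrt\delta$ cancels against the upper bound.
  have hlow := calibration hs.le hac hle (μ / δ)
  rw [ENNReal.ofReal_le_iff_le_toReal hfin, h.zero_left, hxs, norm_zero] at hlow
  simp only [calibrator, Real.sqrt_zero] at hlow
  rw [hxs] at hup
  have h3 : √δ ^ 3 = δ * √δ := by rw [pow_succ, Real.sq_sqrt hδ.le]
  set σ := s / δ ^ (3 / 2 : ℝ) with hσ
  have hsσ : s = σ * (δ * √δ) := by rw [hσ, h32]; field_simp
  have e1 : 2 / 3 * (μ / δ) * √δ ^ 3 = 2 / 3 * μ * √δ := by rw [h3]; field_simp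
  have e2 : (√2 * (μ / δ) + (μ / δ) ^ 2 * δ / 2) * (s - 0) = (√2 * μ + μ ^ 2 / 2) * σ * √δ := by
    rw [hsσ]; field_simp; ring
  rw [e1, e2] at hlow
  rw [hsσ, h32] at hup
  have h22 : √2 * √2 = (2 : ℝ) := Real.mul_self_sqrt (by norm_num)
  have e3 : √2 * s₀ = 2 / 3 := by rw [sq_exitTime hs₀ hs₀']; linarith
  have hfinal : √δ * (√2 * μ * (s₀ - σ)) ≤ √δ * (μ ^ 2 / 2 * σ + C * δ * (σ + s₀)) := by
    have e4 : √2 * μ * (s₀ - σ) = 2 / 3 * μ - √2 * μ * σ := by rw [← e3]; ring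
    rw [← hsσ] at hup
    rw [e4]
    have e5 : C * (s + s₀ * (δ * √δ)) = √δ * (C * δ * (σ + s₀)) := by
      nth_rewrite 1 [hsσ]; ring
    rw [e5] at hup
    linarith
  exact le_of_mul_le_mul_left hfinal hsq

end ExitTimes

/-! ### Lower limit of the rescaled action -/

theorem ofReal_sqrt_le_keplerAction {x : ℝ → Plane} {s : ℝ} (hs : 0 ≤ s)
    (hx : AbsolutelyContinuousOnInterval x 0 s) (h0 : x 0 = 0) :
    ENNReal.ofReal (2 * √2 * √‖x s‖) ≤ keplerAction 0 s x := by
  obtain ⟨d, hd⟩ := hx.exists_bound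
  rw [uIcc_of_le hs] at hd
  simpa [calibrator, h0] using calibration hs hx hd 0

/-- Near $t_0$ the potential is bounded along $x$ and the interval has length at most
$2(s_0+1)\delta^{3/2}$, so after division by $\sqrt\delta$ its contribution is $O(\delta)$. -/
theorem le_liminf_action {U : ℝ → Plane → ℝ} (hU : Continuous (Function.uncurry U)) {x : ℝ → Plane}
    (hx : Continuous x) {t₀ s₀ : ℝ} {tm tp : ℝ → ℝ}
    (hpos : ∀ᶠ δ in 𝓝[>] (0 : ℝ), 0 < tm δ ∧ 0 < tp δ)
    (hm : Tendsto (fun δ => tm δ / δ ^ (3 / 2 : ℝ)) (𝓝[>] 0) (𝓝 s₀))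
    (hp : Tendsto (fun δ => tp δ / δ ^ (3 / 2 : ℝ)) (𝓝[>] 0) (𝓝 s₀))
    (hK : ∀ᶠ δ in 𝓝[>] (0 : ℝ),
      ENNReal.ofReal (4 * √2 * √δ) ≤ keplerAction (t₀ - tm δ) (t₀ + tp δ) x) :
    ((4 * √2 : ℝ) : EReal) ≤ liminf (fun δ => action U (t₀ - tm δ) (t₀ + tp δ) x /
      ((δ ^ (1 / 2 : ℝ) : ℝ) : EReal)) (𝓝[>] 0) := by
  obtain ⟨M, hM⟩ := (isCompact_Icc (a := t₀ - 1) (b := t₀ + 1)).exists_bound_of_continuousOn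
    (f := fun t => U t (x t)) (hU.comp (continuous_id.prodMk hx)).continuousOn
  have hM0 : 0 ≤ M := (norm_nonneg _).trans (hM t₀ ⟨by linarith, by linarith⟩)
  have ht : Tendsto (fun δ : ℝ => ((4 * √2 - 2 * M * (s₀ + 1) * δ : ℝ) : EReal)) (𝓝[>] 0)
      (𝓝 ((4 * √2 - 2 * M * (s₀ + 1) * 0 : ℝ) : EReal)) := by
    have hc : Continuous fun δ : ℝ => ((4 * √2 - 2 * M * (s₀ + 1) * δ : ℝ) : EReal) :=
      continuous_coe_real_ereal.comp (by fun_prop)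
    exact (hc.tendsto 0).mono_left nhdsWithin_le_nhds
  rw [mul_zero, sub_zero] at ht
  rw [← ht.liminf_eq]
  have hsmall : ∀ᶠ δ in 𝓝[>] (0 : ℝ), (s₀ + 1) * δ ^ (3 / 2 : ℝ) < 1 := by
    have hc : Continuous fun δ : ℝ => (s₀ + 1) * δ ^ (3 / 2 : ℝ) :=
      continuous_const.mul (Real.continuous_rpow_const (by norm_num))
    have ht : Tendsto (fun δ : ℝ => (s₀ + 1) * δ ^ (3 / 2 : ℝ)) (𝓝[>] 0) (𝓝 _) :=
      (hc.tendsto 0).mono_left nhdsWithin_le_nhds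
    rw [Real.zero_rpow (by norm_num), mul_zero] at ht
    exact ht.eventually_lt_const one_pos
  refine liminf_le_liminf ?_
  filter_upwards [hpos, hm.eventually_lt_const (lt_add_one s₀),
    hp.eventually_lt_const (lt_add_one s₀), hK, hsmall, self_mem_nhdsWithin] with
    δ ⟨hm0, hp0⟩ hm1 hp1 hKδ hδ1 hδ0
  have hδ : 0 < δ := hδ0
  rw [div_lt_iff₀ (by positivity)] at hm1 hp1
  have hsq : δ ^ (1 / 2 : ℝ) = √δ := (Real.sqrt_eq_rpow δ).symm
  have h32 : δ ^ (3 / 2 : ℝ) = δ * √δ := by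
    rw [Real.sqrt_eq_rpow, ← Real.rpow_one_add' hδ.le (by norm_num)]; norm_num
  have hsp : 0 < √δ := Real.sqrt_pos.2 hδ
  have hint := intervalIntegral.norm_integral_le_of_norm_le_const (a := t₀ - tm δ) (b := t₀ + tp δ)
    (C := M) (f := fun t => U t (x t)) fun t ht => by
      rw [uIoc_of_le (by linarith)] at ht
      exact hM t ⟨by linarith [ht.1], by linarith [ht.2]⟩
  rw [abs_of_pos (by linarith)] at hint
  have hint' := (abs_le.1 hint).1
  have hlen : M * (t₀ + tp δ - (t₀ - tm δ)) ≤ M * (2 * ((s₀ + 1) * (δ * √δ))) := by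
    rw [← h32]
    exact mul_le_mul_of_nonneg_left (by linarith) hM0
  rw [hsq]
  have hact : ((4 * √2 * √δ + ∫ t in (t₀ - tm δ)..(t₀ + tp δ), U t (x t) : ℝ) : EReal) ≤
      action U (t₀ - tm δ) (t₀ + tp δ) x := by
    rw [EReal.coe_add, action]
    gcongr
    rw [← EReal.coe_ennreal_le_coe_ennreal_iff, EReal.coe_ennreal_ofReal,
      max_eq_left (by positivity)] at hKδ
    exact hKδ
  refine le_trans ?_ (EReal.div_le_div_right_of_nonneg (by exact_mod_cast hsp.le) hact)
  rw [← EReal.coe_div, EReal.coe_le_coe_iff, le_div_iff₀ hsp]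
  nlinarith

end ForcedKepler

end

/-! ### Assembly of both branches -/

open ForcedKepler in
theorem lemma3p2 (T : ℝ) (hT : 0 < T)
    (U : ℝ → Plane → ℝ) (hU : ContDiff ℝ 1 (Function.uncurry U))
    (hUT : ∀ t q, U (t + T) q = U t q)
    (C α : ℝ) (hC : 0 < C) (hα : α ∈ Set.Ioo (0 : ℝ) 2)
    (hUg : ∀ t q, |U t q| ≤ C * (1 + ‖q‖ ^ α))
    (x : ℝ → Plane) (hx : IsActionMinimizer U T x)
    (t₀ : ℝ) (ht₀ : t₀ ∈ Set.Icc 0 T) (hcol : x t₀ = 0)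
    (s₀ : ℝ) (hs₀ : 0 < s₀) (hs₀' : (9 / 2 * s₀ ^ 2) ^ (1 / 3 : ℝ) = 1) :
    (∀ᶠ δ in 𝓝[>] (0 : ℝ), ∃! p : ℝ × ℝ, IsExitTimes x t₀ δ p.1 p.2) ∧
    ∀ tm tp : ℝ → ℝ, (∀ᶠ δ in 𝓝[>] (0 : ℝ), IsExitTimes x t₀ δ (tm δ) (tp δ)) →
      Tendsto (fun δ => tm δ / δ ^ (3 / 2 : ℝ)) (𝓝[>] 0) (𝓝 s₀) ∧
      Tendsto (fun δ => tp δ / δ ^ (3 / 2 : ℝ)) (𝓝[>] 0) (𝓝 s₀) ∧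
      ∀ u v : Plane, ‖u‖ = 1 → ‖v‖ = 1 →
        keplerAction (-s₀) s₀ (parabolic u v) = ENNReal.ofReal (4 * 8 ^ (1 / 6 : ℝ)) ∧
        (keplerAction (-s₀) s₀ (parabolic u v) : EReal) ≤
          liminf (fun δ => action U (t₀ - tm δ) (t₀ + tp δ) x /
            ((δ ^ (1 / 2 : ℝ) : ℝ) : EReal)) (𝓝[>] 0) := by
  have hmin := hx.isLoopMinimizer hT
  have hcont := hmin.continuous hT
  have hR := hmin.isCollisionMinimizer hT hUT ht₀ hcol
  have hrev : (fun t => x (-(T - t₀ + t))) = fun t => x (t₀ - t) := funext fun t => by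
    rw [← hmin.periodic]; congr 1; ring
  have hUT' : ∀ t q, U (-(t + T)) q = U (-t) q := fun t q => by
    rw [← hUT (-(t + T))]; congr 1; ring
  -- Reversal sends the collision to $-t_0$; adding a period brings it back into $[0,T]$.
  have hL := (hmin.reverse hT hUT).isCollisionMinimizer hT hUT' (t₀ := T - t₀)
    ⟨by linarith [ht₀.2], by linarith [ht₀.1]⟩ (by simpa [hcol] using congrFun hrev 0)
  simp only [hrev] at hL
  have hUR : ContDiff ℝ 1 (Function.uncurry fun t => U (t₀ + t)) :=
    hU.comp (f := fun p : ℝ × Plane => (t₀ + p.1, p.2)) (by fun_prop)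
  have hUL : ContDiff ℝ 1 (Function.uncurry fun t => U (-(T - t₀ + t))) :=
    hU.comp (f := fun p : ℝ × Plane => (-(T - t₀ + p.1), p.2)) (by fun_prop)
  refine ⟨?_, fun tm tp hexit => ?_⟩
  · obtain ⟨r, hr, hxr⟩ := exists_ne_zero_of_keplerAction hT hL.finite
    obtain ⟨s, hs, hxs⟩ := exists_ne_zero_of_keplerAction hT hR.finite
    have hlt : ∀ {q : Plane}, q ≠ 0 → ∀ᶠ δ in 𝓝[>] (0 : ℝ), δ < ‖q‖ := fun hq =>
      (eventually_lt_nhds (norm_pos_iff.2 hq)).filter_mono nhdsWithin_le_nhds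
    filter_upwards [hlt hxr, hlt hxs, self_mem_nhdsWithin] with δ h1 h2 hδ
    exact exists_isExitTimes hcont hcol hδ hr.1 hs.1 h1.le h2.le
  have hm : Tendsto (fun δ => tm δ / δ ^ (3 / 2 : ℝ)) (𝓝[>] 0) (𝓝 s₀) := by
    refine hL.tendsto_exit hT hUL hs₀ hs₀' ?_
    filter_upwards [hexit] with δ h
    exact ⟨h.left_pos, h.norm_left, fun t ht => h.norm_lt _
      ⟨by linarith [ht.2], by linarith [ht.1, h.right_pos]⟩⟩
  have hp : Tendsto (fun δ => tp δ / δ ^ (3 / 2 : ℝ)) (𝓝[>] 0) (𝓝 s₀) := by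
    refine hR.tendsto_exit hT hUR hs₀ hs₀' ?_
    filter_upwards [hexit] with δ h
    exact ⟨h.right_pos, h.norm_right, fun t ht => h.norm_lt _
      ⟨by linarith [ht.1, h.left_pos], by linarith [ht.2]⟩⟩
  refine ⟨hm, hp, fun u v hu hv => ?_⟩
  rw [eight_rpow_sixth, keplerAction_parabolic hu hv hs₀ hs₀']
  refine ⟨rfl, ?_⟩
  rw [EReal.coe_ennreal_ofReal, max_eq_left (by positivity)]
  refine le_liminf_action hU.continuous hcont (hexit.mono fun δ h => ⟨h.left_pos, h.right_pos⟩)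
    hm hp ?_
  have hLe : ∀ᶠ δ in 𝓝[>] (0 : ℝ), tm δ ≤ T := by
    filter_upwards [hexit, hL.exit_le hT] with δ h hle
    exact (hle _ h.left_pos h.norm_left fun t ht => h.norm_lt _
      ⟨by linarith [ht.2], by linarith [ht.1, h.right_pos]⟩).1
  have hRe : ∀ᶠ δ in 𝓝[>] (0 : ℝ), tp δ ≤ T := by
    filter_upwards [hexit, hR.exit_le hT] with δ h hle
    exact (hle _ h.right_pos h.norm_right fun t ht => h.norm_lt _
      ⟨by linarith [ht.1, h.left_pos], by linarith [ht.2]⟩).1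
  filter_upwards [hexit, hLe, hRe] with δ h hmT hpT
  have hmono : ∀ {y : ℝ → Plane} {r : ℝ}, 0 < r → r ≤ T → AbsolutelyContinuousOnInterval y 0 T →
      AbsolutelyContinuousOnInterval y 0 r := fun h0 hr hy => hy.mono (by
    rw [uIcc_of_le h0.le, uIcc_of_le hT.le]; exact Icc_subset_Icc_right hr)
  have k1 := ofReal_sqrt_le_keplerAction h.left_pos.le (hmono h.left_pos hmT hL.ac) (by simpa)
  have k2 := ofReal_sqrt_le_keplerAction h.right_pos.le (hmono h.right_pos hpT hR.ac) (by simpa)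
  simp only [h.norm_left, h.norm_right] at k1 k2
  have e1 : keplerAction 0 (tm δ) (fun t => x (t₀ - t)) = keplerAction (t₀ - tm δ) t₀ x := by
    simp only [sub_eq_add_neg]
    rw [keplerAction_neg _ _ (fun t => x (t₀ + t)), keplerAction_const_add, neg_zero, add_zero]
  rw [e1] at k1
  rw [keplerAction_const_add, add_zero] at k2
  rw [keplerAction_add (b := t₀) (by linarith [h.left_pos]) (by linarith [h.right_pos])]
  refine le_trans (le_of_eq ?_) (add_le_add k1 k2)
  rw [← ENNReal.ofReal_add (by positivity) (by positivity)]
  congr 1; ring
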